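/- **Setting.** Let $\mathbb X$ be a strict virtual equipment: a virtual double category with all loose-identities $A(1,1)$ (opcartesian nullary 2-cells) and with a chosen restriction $p(f,g)$, exhibited by a cartesian 2-cell, for each loose-cell $p$ and tight-cells $f,g$, such that $p(1,1)=p$ and $p(f,g)(f',g')=p(ff',gg')$, compatibly with the chosen cartesian 2-cells. Loose-cells are written $p\colon X\nrightarrow Y$, and $X(f,g)$ denotes the restriction $X(1,1)(f,g)$. Globular 2-cells $p_1,\dots,p_m\Rightarrow q$ have identity sides; $\cong$ denotes isomorphism by invertible globular 2-cells, or by invertible 2-cells $f\Rightarrow g$ between tight-cells (nullary 2-cells into a loose-identity). A *weight* $\vec p\colon Y\nrightarrow\cdots\nrightarrow Z$ is a chain $(p_1,\dots,p_m)$, $m\ge 0$, of loose-cells $Z=X_0\nleftarrow X_1\nleftarrow\cdots\nleftarrow X_m=Y$. For $q\colon X\nrightarrow Z$, a *right lift* of $q$ through $\vec p$ is a loose-cell $q\blacktriangleleft\vec p\colon X\nrightarrow Y$ with a 2-cell $\varpi\colon p_1,\dots,p_m,\,q\blacktriangleleft\vec p\Rightarrow q$ through which every 2-cell $p_1,\dots,p_m,r_1,\dots,r_n\Rightarrow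 q$ ($n\ge0$) factors via a unique 2-cell $r_1,\dots,r_n\Rightarrow q\blacktriangleleft\vec p$. The weight $\vec p$ is *lifting* if $q\blacktriangleleft\vec p$ exists for every $q$ with codomain $Z$. A loose-cell $p\colon B\nrightarrow A$ is *dense* if $1_p$, regarded as a 2-cell $p,B(1,1)\Rightarrow p$, exhibits $B(1,1)$ as $p\blacktriangleleft p$. A *left-composite* $q\odot_l\vec p$ of $q,p_1,\dots,p_m$ is a loose-cell with a globular 2-cell $q,p_1,\dots,p_m\Rightarrow q\odot_l\vec p$ through which every 2-cell with top $q,p_1,\dots,p_m,r_1,\dots,r_n$ and with left side an identity (the side at the codomain of $q$) factors uniquely. For a weight $\vec p\colon Y\nrightarrow\cdots\nrightarrow Z$ and a tight-cell $f\colon Z\to X$, a *$\vec p$-colimit* of $f$ is a tight-cell $c\colon Y\to X$ with a 2-cell $\lambda\colon\vec p\Rightarrow X(f,c)$ such that the induced 2-cell $\vec p, X(c,1)\Rightarrow X(f,1)$ exhibits $X(c,1)$ as $X(f,1)\blacktriangleleft\vec p$. A tight-cell $g\colon X\to X'$ *preserves* it if $cg$ (that is, $c$ followed by $g$) with the induced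 cocone is a $\vec p$-colimit of $f$ followed by $g$; a loose-cell $q\colon W\nrightarrow X$ *respects* it if the induced 2-cell $\vec p, q(c,1)\Rightarrow q(f,1)$ exhibits $q(c,1)$ as $q(f,1)\blacktriangleleft\vec p$. For a class $\Phi$ of weights, an object $X$ is *$\Phi$-cocomplete* if it admits the $\vec p$-colimit of $f$ for all $\vec p\in\Phi$ and all $f$ into $X$ with domain the codomain of $\vec p$. A tight-cell with $\Phi$-cocomplete domain is *$\Phi$-cocontinuous* if it preserves all $\vec p$-colimits with $\vec p\in\Phi$, and a loose-cell with $\Phi$-cocomplete codomain is *$\Phi$-exact* if it respects all of them. Two classes of weights are *colimit equivalent* if they have the same cocomplete objects, the same cocontinuous tight-cells and the same exact loose-cells; the *colimit saturation* of $\Phi$ is the largest class of weights colimit equivalent to $\Phi$. Let $\mathcal P$ be a class of loose-cells, and $\mathcal P^{\cong}$ its closure under globular isomorphism. A *$\mathcal P$-presheaf object* for $A$ is an object $\mathcal P A$ with a dense loose-cell $\pi_A\colon\mathcal P A\nrightarrow A$ such that (i) for every $p\colon X\nrightarrow A$ in $\mathcal P$ there is a unique tight-cell $\breve p\colon X\to\mathcal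 P A$ with $p=\pi_A(1,\breve p)$, and (ii) $\pi_A(1,f)\in\mathcal P$ for every tight-cell $f\colon X\to\mathcal P A$. The object $A$ is *$\mathcal P$-admissible* if it has a $\mathcal P$-presheaf object and $A(1,1)\in\mathcal P^{\cong}$; the *presheaf embedding* is then the essentially unique tight-cell $y_A\colon A\to\mathcal P A$ with $A(1,1)\cong\pi_A(1,y_A)$. A tight-cell $j\colon A\to E$ *exhibits the $\Phi$-cocompletion of $A$* if: 1. $E$ is $\Phi$-cocomplete; 2. for each tight-cell $f\colon A\to X$ with $X$ $\Phi$-cocomplete, the left extension $\ell\colon E\to X$ of $f$ along $j$ (the $E(j,1)$-colimit of $f$) exists, its unit $f\Rightarrow \ell j$ is invertible, and $\ell$ is the essentially unique $\Phi$-cocontinuous tight-cell $\tilde f\colon E\to X$ with $f\cong \tilde f j$; 3. for each loose-cell $p\colon X\nrightarrow A$, the right lift $p\blacktriangleleft E(j,1)\colon X\nrightarrow E$ exists, the canonical 2-cell $(p\blacktriangleleft E(j,1))(j,1)\Rightarrow p$ is invertible, and $p\blacktriangleleft E(j,1)$ is the essentially unique $\Phi$-exact loose-cell $\tilde p\colon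 X\nrightarrow E$ with $p\cong\tilde p(j,1)$. Here essential uniqueness means: for any other such cell with any such isomorphism, there is a unique invertible 2-cell to or from the given one compatible with the isomorphisms. **Theorem.** Let $\Phi$ be a class of weights and $\mathcal P$ a class of loose-cells in $\mathbb X$, and let $A$ be a $\mathcal P$-admissible object with $\mathcal P$-presheaf object $\pi_A\colon\mathcal P A\nrightarrow A$. Assume: 1. for every $\vec p\in\Phi$ and $q\in\mathcal P$ such that $(q,\vec p)$ is composable, the left-composite $q\odot_l\vec p$ exists and lies in $\mathcal P^{\cong}$; 2. $\pi_A$ (as a weight of length one) is in the colimit saturation of $\Phi$; 3. $\pi_A$ is lifting. Then a presheaf embedding $y_A\colon A\to\mathcal P A$ exists, and every presheaf embedding $y_A$ exhibits the $\Phi$-cocompletion of $A$. -/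

import Mathlib

open CategoryTheory

universe u v w z

noncomputable section

namespace FormalCat

/-! ## Virtual double categories -/

/-- Chains of loose-cells `X₀ ⇷ X₁ ⇷ ⋯ ⇷ Xₘ` (`m ≥ 0`), with `pᵢ : L Xᵢ Xᵢ₋₁`. Such a chain is
an element of `Chain L Xₘ X₀`; `cons p₁ ps` puts `p₁` at the codomain end `X₀`. -/
inductive Chain {Obj : Type u} (L : Obj → Obj → Type w) : Obj → Obj → Type (max u w)
  | nil (A : Obj) : Chain L A A
  | cons {A B C : Obj} (p : L B C) (ps : Chain L A B) : Chain L A C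

namespace Chain

variable {Obj : Type u} {L : Obj → Obj → Type w}

/-- Concatenation `(p₁, …, pₘ, q₁, …, qₙ)`. -/
def append {A B C : Obj} : Chain L B C → Chain L A B → Chain L A C
  | nil _, q => q
  | cons p ps, q => cons p (append ps q)

/-- The chain `(p)`. -/
def single {A B : Obj} (p : L A B) : Chain L A B := cons p (nil A)

theorem append_nil {A B : Obj} (p : Chain L A B) : p.append (nil A) = p := by
  induction p with
  | nil => rfl
  | cons p ps ih => simp [append, ih]

theorem append_assoc {A B C D : Obj} (p : Chain L C D) (q : Chain L B C) (r : Chain L A B) :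
    (p.append q).append r = p.append (q.append r) := by
  induction p with
  | nil => rfl
  | cons p ps ih => simp [append, ih]

end Chain

/-- The type of families of 2-cells: `C f p f' q` is the type of 2-cells with left side `f`,
top side the chain `p`, right side `f'` and bottom side the loose-cell `q`.
```
   A  ⇷ ⋯ p ⋯ ⇷  A'
 f ↓              ↓ f'
   B  ⇷ ── q ──  B'
```
-/
abbrev CellFamily (Obj : Type u) [Category.{v} Obj] (L : Obj → Obj → Type w) :=
  ∀ ⦃A A' B B' : Obj⦄, (A ⟶ B) → Chain L A' A → (A' ⟶ B') → L B' B → Type z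

/-- A row of horizontally adjacent 2-cells `φ₁, …, φₙ` (`n ≥ 0`). In `Row C f p f' q`, the left
side of the row is `f`, the right side is `f'`, `p` is the concatenation of the top sides of the
`φᵢ`, and `q` is the chain of their bottom sides. -/
inductive Row {Obj : Type u} [Category.{v} Obj] {L : Obj → Obj → Type w}
    (C : CellFamily.{u, v, w, z} Obj L) :
    ∀ {A A' B B' : Obj}, (A ⟶ B) → Chain L A' A → (A' ⟶ B') → Chain L B' B →
      Type (max u v w z)
  | nil {A B : Obj} (f : A ⟶ B) : Row C f (Chain.nil A) f (Chain.nil B)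
  | cons {A A₁ A' B B₁ B' : Obj} {f : A ⟶ B} {f₁ : A₁ ⟶ B₁} {f' : A' ⟶ B'}
      {p : Chain L A₁ A} {q : L B₁ B} {ps : Chain L A' A₁} {qs : Chain L B' B₁}
      {pps : Chain L A' A} (φ : C f p f₁ q) (Φ : Row C f₁ ps f' qs)
      (h : pps = p.append ps) : Row C f pps f' (Chain.cons q qs)

namespace Row

variable {Obj : Type u} [Category.{v} Obj] {L : Obj → Obj → Type w}
  {C : CellFamily.{u, v, w, z} Obj L}

/-- The row consisting of one 2-cell. -/
def single {A A' B B' : Obj} {f : A ⟶ B} {f' : A' ⟶ B'} {p : Chain L A' A} {q : L B' B}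
    (φ : C f p f' q) : Row C f p f' (Chain.single q) :=
  cons φ (nil f') p.append_nil.symm

/-- Juxtaposition of rows. -/
def append : ∀ {A A₁ A' B B₁ B' : Obj} {f : A ⟶ B} {f₁ : A₁ ⟶ B₁} {f' : A' ⟶ B'}
    {p : Chain L A₁ A} {q : Chain L B₁ B} {p' : Chain L A' A₁} {q' : Chain L B' B₁},
    Row C f p f₁ q → Row C f₁ p' f' q' → Row C f (p.append p') f' (q.append q')
  | _, _, _, _, _, _, _, _, _, _, _, _, _, nil _, Ψ => Ψ
  | _, _, _, _, _, _, _, _, _, _, _, _, _, cons φ Φ h, Ψ =>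
    cons φ (append Φ Ψ) (by rw [h, Chain.append_assoc])

/-- The row of the 2-cells `one p₁, …, one pₘ`. -/
def ids (one : ∀ ⦃A B : Obj⦄ (p : L A B), C (𝟙 B) (Chain.single p) (𝟙 A) p) {A B : Obj} :
    ∀ p : Chain L A B, Row C (𝟙 B) p (𝟙 A) p
  | Chain.nil A => nil (𝟙 A)
  | Chain.cons p ps => cons (one p) (ids one ps) rfl

end Row

/-- Two storeys of 2-cells: 2-cells `ψ₁, …, ψₙ` side by side, with a row `Φᵢ` on top of
each `ψᵢ`. -/
inductive Grid {Obj : Type u} [Category.{v} Obj] {L : Obj → Obj → Type w}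
    (C : CellFamily.{u, v, w, z} Obj L) :
    ∀ {A A' B B' D D' : Obj}, (A ⟶ B) → Chain L A' A → (A' ⟶ B') → Chain L B' B →
      (B ⟶ D) → (B' ⟶ D') → Chain L D' D → Type (max u v w z)
  | nil {A B D : Obj} (f : A ⟶ B) (g : B ⟶ D) :
      Grid C f (Chain.nil A) f (Chain.nil B) g g (Chain.nil D)
  | cons {A A₁ A' B B₁ B' D D₁ D' : Obj} {f : A ⟶ B} {f₁ : A₁ ⟶ B₁} {f' : A' ⟶ B'}
      {g : B ⟶ D} {g₁ : B₁ ⟶ D₁} {g' : B' ⟶ D'}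
      {p : Chain L A₁ A} {q : Chain L B₁ B} {r : L D₁ D}
      {ps : Chain L A' A₁} {qs : Chain L B' B₁} {rs : Chain L D' D₁}
      (Φ : Row C f p f₁ q) (ψ : C g q g₁ r) (Θ : Grid C f₁ ps f' qs g₁ g' rs) :
      Grid C f (p.append ps) f' (q.append qs) g g' (Chain.cons r rs)

namespace Grid

variable {Obj : Type u} [Category.{v} Obj] {L : Obj → Obj → Type w}
  {C : CellFamily.{u, v, w, z} Obj L}

/-- The upper storey: the juxtaposition of `Φ₁, …, Φₙ`. -/
def top {A A' B B' D D' : Obj} {f : A ⟶ B} {p : Chain L A' A} {f' : A' ⟶ B'} {q : Chain L B' B}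
    {g : B ⟶ D} {g' : B' ⟶ D'} {r : Chain L D' D} :
    Grid C f p f' q g g' r → Row C f p f' q
  | nil f _ => Row.nil f
  | cons Φ _ Θ => Φ.append Θ.top

/-- The lower storey: the row `ψ₁, …, ψₙ`. -/
def bot {A A' B B' D D' : Obj} {f : A ⟶ B} {p : Chain L A' A} {f' : A' ⟶ B'} {q : Chain L B' B}
    {g : B ⟶ D} {g' : B' ⟶ D'} {r : Chain L D' D} :
    Grid C f p f' q g g' r → Row C g q g' r
  | nil _ g => Row.nil g
  | cons _ ψ Θ => Row.cons ψ Θ.bot rfl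

/-- The row of the composites `Φ₁ ⨟ ψ₁, …, Φₙ ⨟ ψₙ`. -/
def paste
    (comp : ∀ ⦃A A' B B' D D' : Obj⦄ ⦃f : A ⟶ B⦄ ⦃f' : A' ⟶ B'⦄ ⦃g : B ⟶ D⦄ ⦃g' : B' ⟶ D'⦄
      ⦃p : Chain L A' A⦄ ⦃q : Chain L B' B⦄ ⦃r : L D' D⦄,
      Row C f p f' q → C g q g' r → C (f ≫ g) p (f' ≫ g') r)
    {A A' B B' D D' : Obj} {f : A ⟶ B} {p : Chain L A' A} {f' : A' ⟶ B'} {q : Chain L B' B}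
    {g : B ⟶ D} {g' : B' ⟶ D'} {r : Chain L D' D} :
    Grid C f p f' q g g' r → Row C (f ≫ g) p (f' ≫ g') r
  | nil f g => Row.nil (f ≫ g)
  | cons Φ ψ Θ => Row.cons (comp Φ ψ) (Θ.paste comp) rfl

end Grid

/-- A virtual double category. Objects and tight-cells are the category `Obj`. The composite of a
row of 2-cells with a 2-cell below it takes the equations for its left and right sides as
arguments, so that no transport along equations between tight-cells is ever needed. -/
class VirtualDoubleCategory (Obj : Type u) extends Category.{v} Obj where
  /-- `Loose A B` is the type of loose-cells from `A` to `B`. -/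
  Loose : Obj → Obj → Type w
  /-- The 2-cells with a given frame. -/
  Cell : CellFamily.{u, v, w, z} Obj Loose
  /-- The identity 2-cell of a loose-cell. -/
  one : ∀ ⦃A B : Obj⦄ (p : Loose A B), Cell (𝟙 B) (Chain.single p) (𝟙 A) p
  /-- The composite `(φ₁, …, φₙ) ⨟ ψ`. -/
  vcomp : ∀ {A A' B B' D D' : Obj} {f : A ⟶ B} {f' : A' ⟶ B'} {g : B ⟶ D} {g' : B' ⟶ D'}
    {p : Chain Loose A' A} {q : Chain Loose B' B} {r : Loose D' D}
    (_ : Row Cell f p f' q) (_ : Cell g q g' r) {k : A ⟶ D} {k' : A' ⟶ D'}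
    (_ : f ≫ g = k) (_ : f' ≫ g' = k'), Cell k p k' r
  one_vcomp : ∀ {A A' B B' : Obj} {f : A ⟶ B} {f' : A' ⟶ B'} {p : Chain Loose A' A}
    {q : Loose B' B} (φ : Cell f p f' q),
    vcomp (Row.ids one p) φ (Category.id_comp f) (Category.id_comp f') = φ
  vcomp_one : ∀ {A A' B B' : Obj} {f : A ⟶ B} {f' : A' ⟶ B'} {p : Chain Loose A' A}
    {q : Loose B' B} (φ : Cell f p f' q),
    vcomp (Row.single φ) (one q) (Category.comp_id f) (Category.comp_id f') = φ
  vcomp_assoc : ∀ {A A' B B' D D' E E' : Obj} {f : A ⟶ B} {f' : A' ⟶ B'} {g : B ⟶ D} {g' : B' ⟶ D'}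
    {h : D ⟶ E} {h' : D' ⟶ E'} {p : Chain Loose A' A} {q : Chain Loose B' B}
    {r : Chain Loose D' D} {s : Loose E' E}
    (Θ : Grid Cell f p f' q g g' r) (χ : Cell h r h' s),
    vcomp (Θ.paste fun _ _ _ _ _ _ _ _ _ _ _ _ _ Φ ψ => vcomp Φ ψ rfl rfl) χ rfl rfl =
      vcomp Θ.top (vcomp Θ.bot χ rfl rfl) (Category.assoc f g h).symm (Category.assoc f' g' h').symm

namespace VirtualDoubleCategory

variable {Obj : Type u} [VirtualDoubleCategory.{u, v, w, z} Obj]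

/-- Weights `p : X ⇷ ⋯ ⇷ Y`, i.e. chains of loose-cells: `Weight Y Z` is the type of chains
`Z = X₀ ⇷ X₁ ⇷ ⋯ ⇷ Xₘ = Y`. -/
abbrev Weight (Y Z : Obj) := Chain (Loose (Obj := Obj)) Y Z

/-- The row of identity 2-cells on a chain. -/
abbrev idRow {A B : Obj} (p : Weight A B) : Row Cell (𝟙 B) p (𝟙 A) p := Row.ids one p

/-- Composite of globular 2-cells `p₁, …, pₘ ⇒ q ⇒ r`. -/
abbrev gcomp {A B : Obj} {p : Weight A B} {q r : Loose A B}
    (φ : Cell (𝟙 B) p (𝟙 A) q) (ψ : Cell (𝟙 B) (Chain.single q) (𝟙 A) r) :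
    Cell (𝟙 B) p (𝟙 A) r :=
  vcomp (Row.single φ) ψ (Category.comp_id _) (Category.comp_id _)

/-- A globular 2-cell `p ⇒ q` between loose-cells is invertible. -/
def IsInvertible {A B : Obj} {p q : Loose A B}
    (φ : Cell (𝟙 B) (Chain.single p) (𝟙 A) q) : Prop :=
  ∃ ψ : Cell (𝟙 B) (Chain.single q) (𝟙 A) p, gcomp φ ψ = one p ∧ gcomp ψ φ = one q

/-- Globular isomorphism `p ≅ q` of loose-cells. -/
def LooseIso {A B : Obj} (p q : Loose A B) : Prop :=
  ∃ φ : Cell (𝟙 B) (Chain.single p) (𝟙 A) q, IsInvertible φ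

/-- Cartesian 2-cells. -/
def IsCartesian {A A' B B' : Obj} {f : A ⟶ B} {f' : A' ⟶ B'} {p : Loose A' A} {q : Loose B' B}
    (κ : Cell f (Chain.single p) f' q) : Prop :=
  ∀ ⦃W W' : Obj⦄ (g : W ⟶ A) (g' : W' ⟶ A') (r : Weight W' W) (φ : Cell (g ≫ f) r (g' ≫ f') q),
    ∃! ψ : Cell g r g' p, vcomp (Row.single ψ) κ rfl rfl = φ

/-- Opcartesian (globular) 2-cells `q₁, …, qₘ ⇒ q`: these exhibit `q` as the loose-composite of
`q₁, …, qₘ`. -/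
def IsOpcartesian {A B : Obj} {qs : Weight A B} {q : Loose A B}
    (ω : Cell (𝟙 B) qs (𝟙 A) q) : Prop :=
  ∀ ⦃W Z S T : Obj⦄ (p : Weight B Z) (r : Weight W A) (f : Z ⟶ T) (g : W ⟶ S) (s : Loose S T)
    (φ : Cell f (p.append (qs.append r)) g s),
    ∃! ψ : Cell f (p.append ((Chain.single q).append r)) g s,
      vcomp ((idRow p).append ((Row.single ω).append (idRow r))) ψ
        (Category.id_comp f) (Category.id_comp g) = φ

/-- Left-opcartesian 2-cells `q₁, …, qₘ ⇒ q`: these exhibit `q` as the left-composite of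
`q₁, …, qₘ`. -/
def IsLeftOpcartesian {A B : Obj} {qs : Weight A B} {q : Loose A B}
    (ω : Cell (𝟙 B) qs (𝟙 A) q) : Prop :=
  ∀ ⦃W S : Obj⦄ (r : Weight W A) (g : W ⟶ S) (s : Loose S B)
    (φ : Cell (𝟙 B) (qs.append r) g s),
    ∃! ψ : Cell (𝟙 B) ((Chain.single q).append r) g s,
      vcomp ((Row.single ω).append (idRow r)) ψ
        (Category.id_comp (𝟙 B)) (Category.id_comp g) = φ

/-- The 2-cell `ϖ : p₁, …, pₘ, l ⇒ q` exhibits `l` as the right lift of `q` through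
`p₁, …, pₘ`. -/
def IsRightLift {X Y Z : Obj} {p : Weight Y Z} {q : Loose X Z} {l : Loose X Y}
    (ϖ : Cell (𝟙 Z) (p.append (Chain.single l)) (𝟙 X) q) : Prop :=
  ∀ (r : Weight X Y) (φ : Cell (𝟙 Z) (p.append r) (𝟙 X) q),
    ∃! ψ : Cell (𝟙 Y) r (𝟙 X) l,
      vcomp ((idRow p).append (Row.single ψ)) ϖ (Category.id_comp _) (Category.id_comp _) = φ

/-- A weight is lifting if all right lifts through it exist. -/
def IsLifting {Y Z : Obj} (p : Weight Y Z) : Prop :=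
  ∀ ⦃X : Obj⦄ (q : Loose X Z), ∃ (l : Loose X Y)
    (ϖ : Cell (𝟙 Z) (p.append (Chain.single l)) (𝟙 X) q), IsRightLift ϖ

variable (Obj) in
/-- Classes of loose-cells. -/
abbrev LooseClass := ∀ ⦃X Y : Obj⦄, Loose X Y → Prop

variable (Obj) in
/-- Classes of weights. -/
abbrev WeightClass := ∀ ⦃Y Z : Obj⦄, Weight Y Z → Prop

/-- The repletion of a class of loose-cells. -/
def repletion (P : LooseClass Obj) : LooseClass Obj :=
  fun _ _ p => ∃ q, P q ∧ LooseIso q p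

end VirtualDoubleCategory

open VirtualDoubleCategory

/-! ## Strict virtual equipments -/

/-- A strict virtual equipment: a virtual double category with loose-identities `A(1, 1)`
(`loId A`) and a strictly functorial choice of restrictions `p(f, g)` (`restr p f g`). -/
class StrictVirtualEquipment (Obj : Type u) [VirtualDoubleCategory.{u, v, w, z} Obj] where
  loId : ∀ A : Obj, Loose A A
  loIdCell : ∀ A : Obj, Cell (𝟙 A) (Chain.nil A) (𝟙 A) (loId A)
  isOpcartesian_loIdCell : ∀ A : Obj, IsOpcartesian (loIdCell A)
  restr : ∀ {A A' B B' : Obj} (_ : Loose B' B) (_ : A ⟶ B) (_ : A' ⟶ B'), Loose A' A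
  cart : ∀ {A A' B B' : Obj} (p : Loose B' B) (f : A ⟶ B) (g : A' ⟶ B'),
    Cell f (Chain.single (restr p f g)) g p
  isCartesian_cart : ∀ {A A' B B' : Obj} (p : Loose B' B) (f : A ⟶ B) (g : A' ⟶ B'),
    IsCartesian (cart p f g)
  restr_id : ∀ {B B' : Obj} (p : Loose B' B), restr p (𝟙 B) (𝟙 B') = p
  cart_id : ∀ {B B' : Obj} (p : Loose B' B), HEq (cart p (𝟙 B) (𝟙 B')) (one p)
  restr_restr : ∀ {D D' A A' B B' : Obj} (p : Loose B' B) (f : A ⟶ B) (g : A' ⟶ B')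
    (f' : D ⟶ A) (g' : D' ⟶ A'), restr (restr p f g) f' g' = restr p (f' ≫ f) (g' ≫ g)
  cart_cart : ∀ {D D' A A' B B' : Obj} (p : Loose B' B) (f : A ⟶ B) (g : A' ⟶ B')
    (f' : D ⟶ A) (g' : D' ⟶ A'),
    HEq (vcomp (Row.single (cart (restr p f g) f' g')) (cart p f g) rfl rfl)
      (cart p (f' ≫ f) (g' ≫ g))

namespace StrictVirtualEquipment

variable {Obj : Type u} [VirtualDoubleCategory.{u, v, w, z} Obj] [StrictVirtualEquipment Obj]

/-- The factorisation of a 2-cell through the chosen cartesian 2-cell. -/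
def factor {A A' B B' W W' : Obj} {q : Loose B' B} {f : A ⟶ B} {f' : A' ⟶ B'}
    {g : W ⟶ A} {g' : W' ⟶ A'} {r : Weight W' W} {k : W ⟶ B} {k' : W' ⟶ B'}
    (φ : Cell k r k' q) (hk : g ≫ f = k) (hk' : g' ≫ f' = k') :
    Cell g r g' (restr q f f') :=
  (isCartesian_cart q f f' g g' r (by rw [hk, hk']; exact φ)).choose

/-- `X(f, g)`. -/
abbrev hom {A A' X : Obj} (f : A ⟶ X) (g : A' ⟶ X) : Loose A' A := restr (loId X) f g

/-! ### 2-cells between tight-cells -/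

/-- 2-cells `f ⇒ g` between tight-cells: nullary 2-cells into the loose-identity. -/
abbrev TightCell {A B : Obj} (f g : A ⟶ B) := Cell f (Chain.nil A) g (loId B)

/-- The identity 2-cell `f ⇒ f`. -/
def tightId {A B : Obj} (f : A ⟶ B) : TightCell f f :=
  vcomp (Row.nil f) (loIdCell B) (Category.comp_id f) (Category.comp_id f)

/-- The canonical 2-cell `Y(1, 1), p ⇒ p`. -/
def leftUnitor {X Y : Obj} (p : Loose X Y) :
    Cell (𝟙 Y) (Chain.cons (loId Y) (Chain.single p)) (𝟙 X) p :=
  (isOpcartesian_loIdCell Y (Chain.nil Y) (Chain.single p) (𝟙 Y) (𝟙 X) p (one p)).choose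

/-- The canonical 2-cell `p, X(1, 1) ⇒ p`. -/
def rightUnitor {X Y : Obj} (p : Loose X Y) :
    Cell (𝟙 Y) (Chain.cons p (Chain.single (loId X))) (𝟙 X) p :=
  (isOpcartesian_loIdCell X (Chain.single p) (Chain.nil X) (𝟙 Y) (𝟙 X) p (one p)).choose

/-- The composite `f ⇒ g ⇒ h`. -/
def tightComp {A B : Obj} {f g h : A ⟶ B} (α : TightCell f g) (β : TightCell g h) :
    TightCell f h :=
  vcomp (Row.cons α (Row.single β) rfl) (leftUnitor (loId B))
    (Category.comp_id f) (Category.comp_id h)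

/-- The whiskering `j ≫ f ⇒ j ≫ g` of `α : f ⇒ g` by `j`. -/
def whiskerLeft {A B D : Obj} (j : A ⟶ B) {f g : B ⟶ D} (α : TightCell f g) :
    TightCell (j ≫ f) (j ≫ g) :=
  vcomp (Row.nil j) α rfl rfl

/-- A 2-cell `f ⇒ g` between tight-cells is invertible. -/
def IsTightInvertible {A B : Obj} {f g : A ⟶ B} (α : TightCell f g) : Prop :=
  ∃ β : TightCell g f, tightComp α β = tightId f ∧ tightComp β α = tightId g

/-- The action of a tight-cell on loose-identities: the 2-cell `X(1, 1) ⇒ X'(1, 1)` with sides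
`g`, whose composite with the nullary cell of `X(1, 1)` is the identity of `g`. -/
def tightMap {X X' : Obj} (g : X ⟶ X') : Cell g (Chain.single (loId X)) g (loId X') :=
  (isOpcartesian_loIdCell X (Chain.nil X) (Chain.nil X) g g (loId X') (tightId g)).choose

/-! ### Weighted colimits -/

/-- A cocone `(c, γ)` for `f` weighted by `p`, where `γ : p₁, …, pₘ ⇒ X(f, c)`. -/
structure Cocone {X Y Z : Obj} (p : Weight Y Z) (f : Z ⟶ X) where
  pt : Y ⟶ X
  leg : Cell (𝟙 Z) p (𝟙 Y) (hom f pt)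

namespace Cocone

variable {X Y Z : Obj} {p : Weight Y Z} {f : Z ⟶ X}

/-- The composite of `γ : p₁, …, pₘ ⇒ X(f, c)` with the cartesian 2-cell of `X(f, c)`. -/
def legCell (γ : Cocone p f) : Cell f p γ.pt (loId X) :=
  vcomp (Row.single γ.leg) (cart (loId X) f γ.pt) (Category.id_comp f) (Category.id_comp γ.pt)

/-- The canonical 2-cell `p₁, …, pₘ, q(c, 1) ⇒ q(f, 1)` induced by `γ` and the action
`X(f, c), q(c, 1) ⇒ q(f, 1)`. -/
def act (γ : Cocone p f) {W : Obj} (q : Loose W X) :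
    Cell (𝟙 Z) (p.append (Chain.single (restr q γ.pt (𝟙 W)))) (𝟙 W) (restr q f (𝟙 W)) :=
  factor
    (vcomp (Row.cons γ.legCell (Row.single (cart q γ.pt (𝟙 W))) rfl) (leftUnitor q)
      (Category.comp_id f) (Category.comp_id (𝟙 W)))
    (Category.id_comp f) (Category.comp_id (𝟙 W))

/-- The cocone is colimiting: the canonical 2-cell `p₁, …, pₘ, X(c, 1) ⇒ X(f, 1)` exhibits
`X(c, 1)` as the right lift of `X(f, 1)` through `p`. -/
def IsColimit (γ : Cocone p f) : Prop := IsRightLift (γ.act (loId X))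

/-- The image `(c ≫ g, γ ⨟ g)` of a cocone under a tight-cell `g`. -/
def map (γ : Cocone p f) {X' : Obj} (g : X ⟶ X') : Cocone p (f ≫ g) where
  pt := γ.pt ≫ g
  leg := factor (vcomp (Row.single γ.legCell) (tightMap g) rfl rfl)
    (Category.id_comp (f ≫ g)) (Category.id_comp (γ.pt ≫ g))

end Cocone

/-- The loose-cell `q` respects the colimit `γ`. -/
def Respects {W X Y Z : Obj} (q : Loose W X) {p : Weight Y Z} {f : Z ⟶ X} (γ : Cocone p f) :
    Prop :=
  IsRightLift (γ.act q)

/-- The tight-cell `g` preserves the colimit `γ`. -/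
def Preserves {X X' Y Z : Obj} (g : X ⟶ X') {p : Weight Y Z} {f : Z ⟶ X} (γ : Cocone p f) :
    Prop :=
  (γ.map g).IsColimit

/-- `Φ`-cocomplete objects. -/
def IsCocomplete (Φ : WeightClass Obj) (X : Obj) : Prop :=
  ∀ ⦃Y Z : Obj⦄ (p : Weight Y Z), Φ p → ∀ f : Z ⟶ X, ∃ γ : Cocone p f, γ.IsColimit

/-- `Φ`-cocontinuous tight-cells. -/
structure IsCocontinuous (Φ : WeightClass Obj) {X X' : Obj} (g : X ⟶ X') : Prop where
  cocomplete : IsCocomplete Φ X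
  preserves : ∀ ⦃Y Z : Obj⦄ (p : Weight Y Z), Φ p → ∀ (f : Z ⟶ X) (γ : Cocone p f),
    γ.IsColimit → Preserves g γ

/-- `Φ`-exact loose-cells. -/
structure IsExact (Φ : WeightClass Obj) {W X : Obj} (q : Loose W X) : Prop where
  cocomplete : IsCocomplete Φ X
  respects : ∀ ⦃Y Z : Obj⦄ (p : Weight Y Z), Φ p → ∀ (f : Z ⟶ X) (γ : Cocone p f),
    γ.IsColimit → Respects q γ

/-! ### Colimit saturation -/

/-- The preorder `Φ ≲ Φ'` on classes of weights. -/
structure ColimitLE (Φ Φ' : WeightClass Obj) : Prop where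
  cocomplete : ∀ X : Obj, IsCocomplete Φ' X → IsCocomplete Φ X
  cocontinuous : ∀ ⦃X X' : Obj⦄ (g : X ⟶ X'), IsCocontinuous Φ' g → IsCocontinuous Φ g
  exact : ∀ ⦃W X : Obj⦄ (q : Loose W X), IsExact Φ' q → IsExact Φ q

/-- Colimit equivalence of classes of weights. -/
def ColimitEquiv (Φ Φ' : WeightClass Obj) : Prop := ColimitLE Φ Φ' ∧ ColimitLE Φ' Φ

/-- The colimit saturation of `Φ`, i.e. the largest class of weights colimit equivalent to `Φ`
(see `saturation_spec`), constructed as the union of all such classes. -/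
def saturation (Φ : WeightClass Obj) : WeightClass Obj :=
  fun _ _ p => ∃ Ψ : WeightClass Obj, ColimitEquiv Ψ Φ ∧ Ψ p

theorem saturation_spec (Φ : WeightClass Obj) :
    ColimitEquiv (saturation Φ) Φ ∧
      ∀ Ψ : WeightClass Obj, ColimitEquiv Ψ Φ →
        ∀ ⦃Y Z : Obj⦄ (p : Weight Y Z), Ψ p → saturation Φ p := by
  have hrefl : ColimitEquiv Φ Φ :=
    ⟨⟨fun _ h => h, fun _ _ _ h => h, fun _ _ _ h => h⟩,
      ⟨fun _ h => h, fun _ _ _ h => h, fun _ _ _ h => h⟩⟩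
  have hsub : ∀ ⦃Y Z : Obj⦄ (p : Weight Y Z), Φ p → saturation Φ p :=
    fun _ _ p hp => ⟨Φ, hrefl, hp⟩
  have hcoc : ∀ X : Obj, IsCocomplete Φ X → IsCocomplete (saturation Φ) X :=
    fun X hX _ _ p ⟨Ψ, hΨ, hp⟩ => hΨ.1.cocomplete X hX p hp
  have hcoc' : ∀ X : Obj, IsCocomplete (saturation Φ) X → IsCocomplete Φ X :=
    fun X hX _ _ p hp => hX p (hsub p hp)
  refine ⟨⟨⟨hcoc, ?_, ?_⟩, ⟨hcoc', ?_, ?_⟩⟩, fun Ψ hΨ _ _ p hp => ⟨Ψ, hΨ, hp⟩⟩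
  · exact fun X X' g hg => ⟨hcoc X hg.cocomplete,
      fun _ _ p ⟨Ψ, hΨ, hp⟩ => (hΨ.1.cocontinuous g hg).preserves p hp⟩
  · exact fun W X q hq => ⟨hcoc X hq.cocomplete,
      fun _ _ p ⟨Ψ, hΨ, hp⟩ => (hΨ.1.exact q hq).respects p hp⟩
  · exact fun X X' g hg => ⟨hcoc' X hg.cocomplete, fun _ _ p hp => hg.preserves p (hsub p hp)⟩
  · exact fun W X q hq => ⟨hcoc' X hq.cocomplete, fun _ _ p hp => hq.respects p (hsub p hp)⟩

/-! ### Presheaf objects -/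

/-- A loose-cell `p : B ⇸ A` is dense if its identity 2-cell, viewed as a 2-cell
`p, B(1, 1) ⇒ p`, exhibits `B(1, 1)` as the right lift of `p` through `p`. -/
def IsDense {A B : Obj} (p : Loose B A) : Prop :=
  IsRightLift (p := Chain.single p) (rightUnitor p)

/-- `π : PA ⇸ A` exhibits `PA` as the `P`-presheaf object for `A`. -/
structure IsPresheafObject (P : LooseClass Obj) {A PA : Obj} (π : Loose PA A) : Prop where
  dense : IsDense π
  existsUnique : ∀ ⦃X : Obj⦄ (p : Loose X A), P p → ∃! f : X ⟶ PA, p = restr π (𝟙 A) f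
  mem : ∀ ⦃X : Obj⦄ (f : X ⟶ PA), P (restr π (𝟙 A) f)

/-- `y : A ⟶ PA` is the presheaf embedding with respect to `π : PA ⇸ A`:
`A(1, 1) ≅ π(1, y)`. -/
def IsPresheafEmbedding {A PA : Obj} (π : Loose PA A) (y : A ⟶ PA) : Prop :=
  LooseIso (loId A) (restr π (𝟙 A) y)

/-! ### Cocompletions -/

/-- The universal 2-cell of the conjoint `E(j, 1)`. -/
def conjointUnit {A E : Obj} (j : A ⟶ E) :
    Cell (𝟙 A) (Chain.nil A) j (hom j (𝟙 E)) :=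
  factor (tightId j) (Category.id_comp j) (Category.comp_id j)

/-- The unit `f ⇒ j ≫ c` of a cocone `(c, γ)` for `f` weighted by `E(j, 1)`. -/
def extUnit {A E X : Obj} {j : A ⟶ E} {f : A ⟶ X}
    (γ : Cocone (Chain.single (hom j (𝟙 E))) f) : TightCell f (j ≫ γ.pt) :=
  vcomp (Row.single (conjointUnit j)) γ.legCell (Category.id_comp f) rfl

/-- The canonical 2-cell `l(j, 1) ⇒ p` induced by a 2-cell `ϖ : E(j, 1), l ⇒ p`. -/
def liftCounit {A E X : Obj} {j : A ⟶ E} {l : Loose X E} {p : Loose X A}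
    (ϖ : Cell (𝟙 A) (Chain.cons (hom j (𝟙 E)) (Chain.single l)) (𝟙 X) p) :
    Cell (𝟙 A) (Chain.single (restr l j (𝟙 X))) (𝟙 X) p :=
  vcomp (Row.cons (conjointUnit j) (Row.single (cart l j (𝟙 X))) rfl) ϖ
    (Category.comp_id (𝟙 A)) (Category.comp_id (𝟙 X))

/-- The 2-cell `σ(f, g) : p(f, g) ⇒ q(f, g)` induced by a globular 2-cell `σ : p ⇒ q`. -/
def restrMap {A A' B B' : Obj} {p q : Loose B' B}
    (σ : Cell (𝟙 B) (Chain.single p) (𝟙 B') q) (f : A ⟶ B) (g : A' ⟶ B') :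
    Cell (𝟙 A) (Chain.single (restr p f g)) (𝟙 A') (restr q f g) :=
  factor (vcomp (Row.single (cart p f g)) σ (Category.comp_id f) (Category.comp_id g))
    (Category.id_comp f) (Category.id_comp g)

/-- `j : A ⟶ E` exhibits `E` as the `Φ`-cocompletion of `A`. Essential uniqueness is uniqueness up
to a unique invertible 2-cell compatible with the given isomorphisms. -/
structure IsCocompletion (Φ : WeightClass Obj) {A E : Obj} (j : A ⟶ E) : Prop where
  cocomplete : IsCocomplete Φ E
  /-- The universal property with respect to tight-cells; `γ.pt` is the left extension of `f`
  along `j`. -/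
  tight : ∀ ⦃X : Obj⦄ (f : A ⟶ X), IsCocomplete Φ X →
    ∃ γ : Cocone (Chain.single (hom j (𝟙 E))) f, γ.IsColimit ∧
      IsTightInvertible (extUnit γ) ∧ IsCocontinuous Φ γ.pt ∧
      ∀ f' : E ⟶ X, IsCocontinuous Φ f' →
        ∀ θ : TightCell f (j ≫ f'), IsTightInvertible θ →
          ∃! σ : TightCell γ.pt f',
            IsTightInvertible σ ∧ tightComp (extUnit γ) (whiskerLeft j σ) = θ
  /-- The universal property with respect to loose-cells; `l` is the right lift of `p` through
  `E(j, 1)`. -/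
  loose : ∀ ⦃X : Obj⦄ (p : Loose X A),
    ∃ (l : Loose X E) (ϖ : Cell (𝟙 A) (Chain.cons (hom j (𝟙 E)) (Chain.single l)) (𝟙 X) p),
      IsRightLift (p := Chain.single (hom j (𝟙 E))) ϖ ∧
      IsInvertible (liftCounit ϖ) ∧ IsExact Φ l ∧
      ∀ p' : Loose X E, IsExact Φ p' →
        ∀ θ : Cell (𝟙 A) (Chain.single (restr p' j (𝟙 X))) (𝟙 X) p, IsInvertible θ →
          ∃! σ : Cell (𝟙 E) (Chain.single p') (𝟙 X) l,
            IsInvertible σ ∧ gcomp (restrMap σ j (𝟙 X)) (liftCounit ϖ) = θ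

end StrictVirtualEquipment

end FormalCat

end

open CategoryTheory FormalCat VirtualDoubleCategory StrictVirtualEquipment

/-! Everything reduces to one notion, `Lifts κ ϖ`: for a 2-cell `κ` into `π` and a 2-cell `ϖ : π, l
⇒ q`, the map sending `φ` to the row `(κ, φ)` followed by `ϖ` is bijective. Right lifts are the case
where `κ` is the identity of `π` (`lifts_one_iff`). A loose-cell `q` respects a cocone exactly when
the cocone lifts along the action of the unit on `q` (`respects_iff`), and colimits are the case
where `q` is a loose-identity (`isColimit_iff`). A 2-cell between tight-cells that lifts along the
action of the unit on itself is invertible. Such 2-cells are stable under restricting `π` to `π(1,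
c)` (`lifts_cart`) and under precomposition with left-opcartesian 2-cells (`Lifts.leftOpcartesian`),
and they satisfy two-out-of-three (`Lifts.pair_iff`).

Colimits in `PA` are built as follows (`IsPresheafObject.exists_lifts`). For `p` in `Φ` and `f` into
`PA`, the left-composite of `π(1, f)` and `p` is isomorphic to some `π(1, c)`. The resulting 2-cell
`π(1, f), p ⇒ π` lifts along every right lift through `π`, and by density it comes from a 2-cell `κ`
from `p` with sides `f` and `c`. Two-out-of-three then says that every right lift through `π`
respects `κ`. Density makes `PA(1, 1)` such a right lift, so `κ` is a colimit. Hence `PA` is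
cocomplete and all right lifts through `π` are exact.

The isomorphism `A(1, 1) ≅ π(1, y)` yields a 2-cell `η`, and density yields `ζ`; together they make
`π` the conjoint of `y` (`exists_isConjoint`). Moreover `ζ` exhibits the identity of `PA` as the
`π`-colimit of `y`. By saturation, a `Φ`-cocomplete `X` has the `π`-colimit `c` of any `f : A ⟶ X`.
Then `X(c, 1)` is a right lift through `π`, hence exact, so `c` is cocontinuous. The unit is
invertible because `η` lifts along right lifts through `π`. A cocontinuous `f'` preserves the
colimit `ζ`, hence is itself the `π`-colimit of `y ≫ f'`, which gives uniqueness. The loose case is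
parallel: the lift exists since `π` is lifting, and an exact `p'` is the right lift of `p'(y, 1)`
through `π` because it respects `ζ`. -/

namespace FormalCat

/-! ### Rows of 2-cells, and associativity up to propositional equality of frames. -/

namespace VirtualDoubleCategory

variable {Obj : Type u} [VirtualDoubleCategory.{u, v, w, z} Obj]

/-- `IsAppend Φ Ψ Ξ` states that the row `Ξ` is the juxtaposition of `Φ` and `Ψ`, without
requiring its top and bottom sides to be syntactically concatenations. -/
inductive IsAppend : ∀ {A A₁ A' B B₁ B' : Obj} {f : A ⟶ B} {f₁ : A₁ ⟶ B₁} {f' : A' ⟶ B'}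
    {p : Weight A₁ A} {q : Weight B₁ B} {p' : Weight A' A₁} {q' : Weight B' B₁}
    {pp : Weight A' A} {qq : Weight B' B},
    Row Cell f p f₁ q → Row Cell f₁ p' f' q' → Row Cell f pp f' qq → Prop
  | nil {A A' B B' : Obj} {f : A ⟶ B} {f' : A' ⟶ B'} {p : Weight A' A} {q : Weight B' B}
      (Φ : Row Cell f p f' q) : IsAppend (Row.nil f) Φ Φ
  | cons {A A₀ A₁ A' B B₀ B₁ B' : Obj} {f : A ⟶ B} {f₀ : A₀ ⟶ B₀} {f₁ : A₁ ⟶ B₁} {f' : A' ⟶ B'}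
      {p₀ : Weight A₀ A} {q₀ : Loose B₀ B} {p : Weight A₁ A₀} {q : Weight B₁ B₀}
      {p' : Weight A' A₁} {q' : Weight B' B₁} {pp : Weight A' A₀} {qq : Weight B' B₀}
      {ps : Weight A₁ A} {pps : Weight A' A}
      (φ : Cell f p₀ f₀ q₀) {Φ : Row Cell f₀ p f₁ q} {Ψ : Row Cell f₁ p' f' q'}
      {Ξ : Row Cell f₀ pp f' qq} (h : ps = p₀.append p) (h' : pps = p₀.append pp)
      (H : IsAppend Φ Ψ Ξ) : IsAppend (Row.cons φ Φ h) Ψ (Row.cons φ Ξ h')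

/-- `IsPasting Φ Ψ Ξ` states that the row `Ξ` is the vertical composite of `Φ` with the row `Ψ`
below it. -/
inductive IsPasting : ∀ {A A' B B' D D' : Obj} {f : A ⟶ B} {f' : A' ⟶ B'} {g : B ⟶ D}
    {g' : B' ⟶ D'} {k : A ⟶ D} {k' : A' ⟶ D'} {p : Weight A' A} {q : Weight B' B}
    {r : Weight D' D}, Row Cell f p f' q → Row Cell g q g' r → Row Cell k p k' r → Prop
  | nil {A B D : Obj} {f : A ⟶ B} {g : B ⟶ D} {k : A ⟶ D} (h : f ≫ g = k) :
      IsPasting (Row.nil f) (Row.nil g) (Row.nil k)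
  | cons {A A₁ A' B B₁ B' D D₁ D' : Obj} {f : A ⟶ B} {f₁ : A₁ ⟶ B₁} {f' : A' ⟶ B'} {g : B ⟶ D}
      {g₁ : B₁ ⟶ D₁} {g' : B' ⟶ D'} {k : A ⟶ D} {k₁ : A₁ ⟶ D₁} {k' : A' ⟶ D'}
      {p : Weight A₁ A} {q : Weight B₁ B} {r : Loose D₁ D}
      {p' : Weight A' A₁} {q' : Weight B' B₁} {r' : Weight D' D₁}
      {pp : Weight A' A} {qq : Weight B' B}
      {Φ : Row Cell f p f₁ q} (ψ : Cell g q g₁ r) {Φ' : Row Cell f₁ p' f' q'}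
      {ΦΦ : Row Cell f pp f' qq} {Ψ' : Row Cell g₁ q' g' r'} {Ξ' : Row Cell k₁ p' k' r'}
      (e : f ≫ g = k) (e₁ : f₁ ≫ g₁ = k₁) (hp : pp = p.append p') (hq : qq = q.append q')
      (H : IsAppend Φ Φ' ΦΦ) (H' : IsPasting Φ' Ψ' Ξ') :
      IsPasting ΦΦ (Row.cons ψ Ψ' hq) (Row.cons (vcomp Φ ψ e e₁) Ξ' hp)

section

variable {A A₁ A' B B₁ B' D D' : Obj} {f : A ⟶ B} {f₁ : A₁ ⟶ B₁} {f' : A' ⟶ B'}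

theorem IsAppend.top_eq {p : Weight A₁ A} {q : Weight B₁ B} {p' : Weight A' A₁}
    {q' : Weight B' B₁} {pp : Weight A' A} {qq : Weight B' B}
    {Φ : Row Cell f p f₁ q} {Ψ : Row Cell f₁ p' f' q'} {Ξ : Row Cell f pp f' qq}
    (H : IsAppend Φ Ψ Ξ) : pp = p.append p' := by
  induction H with
  | nil Φ => rfl
  | cons φ h h' H ih => subst h h' ih; exact (Chain.append_assoc _ _ _).symm

theorem IsAppend.bot_eq {p : Weight A₁ A} {q : Weight B₁ B} {p' : Weight A' A₁}
    {q' : Weight B' B₁} {pp : Weight A' A} {qq : Weight B' B}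
    {Φ : Row Cell f p f₁ q} {Ψ : Row Cell f₁ p' f' q'} {Ξ : Row Cell f pp f' qq}
    (H : IsAppend Φ Ψ Ξ) : qq = q.append q' := by
  induction H with
  | nil Φ => rfl
  | cons φ h h' H ih => subst ih; rfl

/-- Frames of juxtaposed rows agree only propositionally, so heterogeneous equality is needed here;
later arguments use `IsAppend` and avoid transport. -/
theorem IsAppend.heq {p : Weight A₁ A} {q : Weight B₁ B} {p' : Weight A' A₁}
    {q' : Weight B' B₁} {pp : Weight A' A} {qq : Weight B' B}
    {Φ : Row Cell f p f₁ q} {Ψ : Row Cell f₁ p' f' q'} {Ξ : Row Cell f pp f' qq}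
    (H : IsAppend Φ Ψ Ξ) : HEq (Φ.append Ψ) Ξ := by
  induction H with
  | nil Φ => rfl
  | @cons _ _ _ _ _ _ _ _ _ _ _ _ p₀ q₀ _ _ _ _ _ _ ps pps φ Φ Ψ Ξ h h' H ih =>
    have e := H.top_eq
    have e' := H.bot_eq
    subst e e' h
    have h'' := h'
    rw [← Chain.append_assoc] at h''
    subst h''
    cases ih
    rfl

theorem IsAppend.append {p : Weight A₁ A} {q : Weight B₁ B} {p' : Weight A' A₁}
    {q' : Weight B' B₁} (Φ : Row Cell f p f₁ q) (Ψ : Row Cell f₁ p' f' q') :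
    IsAppend Φ Ψ (Φ.append Ψ) := by
  induction Φ with
  | nil => exact IsAppend.nil _
  | cons φ Φ h ih => exact IsAppend.cons _ _ _ (ih _)

theorem IsAppend.append_nil {p : Weight A' A} {q : Weight B' B} (Φ : Row Cell f p f' q) :
    IsAppend Φ (Row.nil f') Φ := by
  induction Φ with
  | nil => exact IsAppend.nil _
  | cons φ Φ h ih => exact IsAppend.cons _ _ _ ih

theorem IsPasting.exists_grid {g : B ⟶ D} {g' : B' ⟶ D'} {k : A ⟶ D} {k' : A' ⟶ D'}
    {p : Weight A' A} {q : Weight B' B} {r : Weight D' D} {Φ : Row Cell f p f' q}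
    {Ψ : Row Cell g q g' r} {Ξ : Row Cell k p k' r} (H : IsPasting Φ Ψ Ξ) :
    ∃ (_ : f ≫ g = k) (_ : f' ≫ g' = k') (Θ : Grid Cell f p f' q g g' r),
      Θ.top = Φ ∧ Θ.bot = Ψ ∧
        HEq (Θ.paste fun _ _ _ _ _ _ _ _ _ _ _ _ _ Φ ψ => vcomp Φ ψ rfl rfl) Ξ := by
  induction H with
  | nil h => subst h; exact ⟨rfl, rfl, Grid.nil _ _, rfl, rfl, HEq.rfl⟩
  | @cons _ _ _ _ _ _ _ _ _ _ _ _ _ _ _ _ _ _ _ _ _ _ _ _ _ _ Φ ψ _ _ _ _ e e₁ hp hq H H' ih =>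
    obtain ⟨e₂, e', Θ, rfl, rfl, h⟩ := ih
    have hh := H.heq
    subst e e₁ e' hp hq
    cases hh
    cases h
    exact ⟨rfl, rfl, Grid.cons Φ ψ Θ, rfl, rfl, HEq.rfl⟩

/-- The axiom `vcomp_assoc` freed from `Grid` and from definitional constraints on the sides. All
later uses of associativity go through this form. -/
theorem IsPasting.vcomp_eq {E E' : Obj} {g : B ⟶ D} {g' : B' ⟶ D'} {k : A ⟶ D} {k' : A' ⟶ D'}
    {h : D ⟶ E} {h' : D' ⟶ E'} {j : A ⟶ E} {j' : A' ⟶ E'} {i : B ⟶ E} {i' : B' ⟶ E'}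
    {p : Weight A' A} {q : Weight B' B} {r : Weight D' D} {s : Loose E' E}
    {Φ : Row Cell f p f' q}
    {Ψ : Row Cell g q g' r} {Ξ : Row Cell k p k' r} (H : IsPasting Φ Ψ Ξ) (χ : Cell h r h' s)
    (e₁ : g ≫ h = i) (e₁' : g' ≫ h' = i') (e₂ : f ≫ i = j) (e₂' : f' ≫ i' = j')
    (e₃ : k ≫ h = j) (e₃' : k' ≫ h' = j') :
    vcomp Φ (vcomp Ψ χ e₁ e₁') e₂ e₂' = vcomp Ξ χ e₃ e₃' := by
  obtain ⟨e, e', Θ, rfl, rfl, hΞ⟩ := H.exists_grid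
  subst e e' e₁ e₁' e₃ e₃'
  cases hΞ
  exact (vcomp_assoc Θ χ).symm

theorem IsAppend.idRow {A B D : Obj} (p : Weight B D) (q : Weight A B) :
    IsAppend (idRow p) (idRow q) (idRow (p.append q)) := by
  induction p with
  | nil => exact IsAppend.nil _
  | cons a p ih => exact IsAppend.cons _ _ _ ih

theorem IsPasting.idRow_left {p : Weight A' A} {q : Weight B' B} (Ψ : Row Cell f p f' q) :
    IsPasting (idRow p) Ψ Ψ := by
  induction Ψ with
  | nil f => exact IsPasting.nil (Category.id_comp f)
  | cons ψ Ψ h ih =>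
    subst h
    have := IsPasting.cons ψ (Category.id_comp _) (Category.id_comp _) rfl rfl
      (IsAppend.idRow _ _) ih
    rw [one_vcomp] at this
    exact this

end

/-! ### Pairing, precomposition and invertible globular 2-cells. -/

/-- The composite of the row `(κ, φ)` with a globular 2-cell. -/
def pair {Z B E Y V W : Obj} {f : Z ⟶ B} {c : Y ⟶ E} {g : V ⟶ W} {p : Weight Y Z}
    {π : Loose E B} {r : Weight V Y} {l : Loose W E} {q : Loose W B} {pp : Weight V Z}
    (κ : Cell f p c π) (φ : Cell c r g l)
    (ϖ : Cell (𝟙 B) (Chain.cons π (Chain.single l)) (𝟙 W) q) (h : pp = p.append r) :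
    Cell f pp g q :=
  vcomp (Row.cons κ (Row.single φ) h) ϖ (Category.comp_id f) (Category.comp_id g)

section

variable {A A₁ A' B B₁ B' D D' E E' : Obj} {f : A ⟶ B} {f' : A' ⟶ B'}

/-- Associativity of vertical composition in a column. -/
theorem vcomp_vcomp {g : B ⟶ D} {g' : B' ⟶ D'} {h : D ⟶ E} {h' : D' ⟶ E'}
    {j : A ⟶ E} {j' : A' ⟶ E'} {i : B ⟶ E} {i' : B' ⟶ E'} {k : A ⟶ D} {k' : A' ⟶ D'}
    {p : Weight A' A} {q : Weight B' B} {r : Loose D' D} {s : Loose E' E}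
    (Φ : Row Cell f p f' q) (ψ : Cell g q g' r) (χ : Cell h (Chain.single r) h' s)
    (e₁ : g ≫ h = i) (e₁' : g' ≫ h' = i') (e₂ : f ≫ i = j) (e₂' : f' ≫ i' = j')
    (e₄ : f ≫ g = k) (e₄' : f' ≫ g' = k') (e₃ : k ≫ h = j) (e₃' : k' ≫ h' = j') :
    vcomp (Row.single (vcomp Φ ψ e₄ e₄')) χ e₃ e₃' =
      vcomp Φ (vcomp (Row.single ψ) χ e₁ e₁') e₂ e₂' :=
  (IsPasting.vcomp_eq (IsPasting.cons ψ e₄ e₄' _ _ (IsAppend.append_nil Φ) (IsPasting.nil e₄'))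
    χ e₁ e₁' e₂ e₂' e₃ e₃').symm

theorem vcomp_one' {p : Weight A' A} {q : Loose B' B} (φ : Cell f p f' q)
    (h : p = p.append (Chain.nil A')) (e : f ≫ 𝟙 B = f) (e' : f' ≫ 𝟙 B' = f') :
    vcomp (Row.cons φ (Row.nil f') h) (one q) e e' = φ :=
  vcomp_one φ

theorem idRow_vcomp {p : Weight A' A} {q : Loose B' B} (φ : Cell f p f' q)
    (e : 𝟙 A ≫ f = f) (e' : 𝟙 A' ≫ f' = f') : vcomp (idRow p) φ e e' = φ :=
  one_vcomp φ

end

section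

variable {Z Z' B E Y Y' V V' W W' : Obj}

/-- Precomposition of a pairing with a pair of rows. -/
theorem vcomp_pair {f : Z ⟶ B} {c : Y ⟶ E} {g : V ⟶ W} {p : Weight Y Z}
    {π : Loose E B} {r : Weight V Y} {l : Loose W E} {q : Loose W B} {pp : Weight V Z}
    {a : Z' ⟶ Z} {b : Y' ⟶ Y} {d : V' ⟶ V} {p' : Weight Y' Z'} {r' : Weight V' Y'}
    {pp' : Weight V' Z'} {k : Z' ⟶ B} {k₁ : Y' ⟶ E} {k' : V' ⟶ W}
    {Φ : Row Cell a p' b p} {Ψ : Row Cell b r' d r} {Ξ : Row Cell a pp' d pp}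
    (H : IsAppend Φ Ψ Ξ)
    (κ : Cell f p c π) (φ : Cell c r g l)
    (ϖ : Cell (𝟙 B) (Chain.cons π (Chain.single l)) (𝟙 W) q) (h : pp = p.append r)
    (h' : pp' = p'.append r')
    (e : a ≫ f = k) (e₁ : b ≫ c = k₁) (e' : d ≫ g = k') :
    vcomp Ξ (pair κ φ ϖ h) e e' = pair (vcomp Φ κ e e₁) (vcomp Ψ φ e₁ e') ϖ h' :=
  IsPasting.vcomp_eq (IsPasting.cons κ e e₁ h' h H (IsPasting.cons φ e₁ e'
    (Chain.append_nil _).symm _ (IsAppend.append_nil Ψ) (IsPasting.nil e'))) ϖ _ _ _ _ _ _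

/-- Postcomposition of a pairing. -/
theorem pair_vcomp {f : Z ⟶ B} {c : Y ⟶ E} {g : V ⟶ W} {p : Weight Y Z}
    {π : Loose E B} {r : Weight V Y} {l : Loose W E} {q : Loose W B} {pp : Weight V Z}
    (κ : Cell f p c π) (φ : Cell c r g l)
    (ϖ : Cell (𝟙 B) (Chain.cons π (Chain.single l)) (𝟙 W) q) (h : pp = p.append r)
    {b : B ⟶ Z'} {w : W ⟶ W'} {s : Loose W' Z'} (ψ : Cell b (Chain.single q) w s)
    {k : Z ⟶ Z'} {k' : V ⟶ W'} (e : f ≫ b = k) (e' : g ≫ w = k') :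
    vcomp (Row.single (pair κ φ ϖ h)) ψ e e' =
      vcomp (Row.cons κ (Row.single φ) h)
        (vcomp (Row.single ϖ) ψ (Category.id_comp b) (Category.id_comp w)) e e' :=
  vcomp_vcomp _ _ _ _ _ _ _ _ _ _ _

end

section

variable {A B D E S T V W X Y Z : Obj}

/-- Precomposition of a 2-cell with a globular 2-cell in the leftmost place. -/
def precomp {qs : Weight A B} {q : Loose A B} (ω : Cell (𝟙 B) qs (𝟙 A) q) {r : Weight W A}
    {f : B ⟶ T} {g : W ⟶ S} {s : Loose S T} (χ : Cell f (Chain.cons q r) g s) :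
    Cell f (qs.append r) g s :=
  vcomp ((Row.single ω).append (idRow r)) χ (Category.id_comp f) (Category.id_comp g)

theorem precomp_one {q : Loose A B} {r : Weight W A}
    {f : B ⟶ T} {g : W ⟶ S} {s : Loose S T} (χ : Cell f (Chain.cons q r) g s) :
    precomp (one q) χ = χ :=
  idRow_vcomp χ _ _

theorem precomp_precomp {qs : Weight A B} {q q' : Loose A B} (ω : Cell (𝟙 B) qs (𝟙 A) q)
    (φ : Cell (𝟙 B) (Chain.single q) (𝟙 A) q') {r : Weight W A}
    {f : B ⟶ T} {g : W ⟶ S} {s : Loose S T} (χ : Cell f (Chain.cons q' r) g s) :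
    precomp ω (precomp φ χ) = precomp (gcomp ω φ) χ :=
  IsPasting.vcomp_eq (IsPasting.cons φ (Category.comp_id _) (Category.comp_id _) _ rfl
    (IsAppend.append (Row.single ω) (idRow r)) (IsPasting.idRow_left (idRow r))) χ _ _ _ _ _ _

theorem precomp_pair {qs : Weight A B} {q : Loose A B} (ω : Cell (𝟙 B) qs (𝟙 A) q)
    {f : B ⟶ D} {c : A ⟶ E} {g : V ⟶ W} {π : Loose E D} {r : Weight V A} {l : Loose W E}
    {m : Loose W D} (κ : Cell f (Chain.single q) c π) (φ : Cell c r g l)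
    (ϖ : Cell (𝟙 D) (Chain.cons π (Chain.single l)) (𝟙 W) m) :
    precomp ω (pair κ φ ϖ rfl) =
      pair (vcomp (Row.single ω) κ (Category.id_comp f) (Category.id_comp c)) φ ϖ rfl := by
  have h := vcomp_pair (IsAppend.append (Row.single ω) (idRow r)) κ φ ϖ rfl rfl
    (Category.id_comp f) (Category.id_comp c) (Category.id_comp g)
  rwa [idRow_vcomp] at h

theorem precomp_bijective {q q' : Loose A B} {φ : Cell (𝟙 B) (Chain.single q) (𝟙 A) q'}
    (hφ : IsInvertible φ) {r : Weight W A} {f : B ⟶ T} {g : W ⟶ S} {s : Loose S T} :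
    Function.Bijective fun χ : Cell f (Chain.cons q' r) g s => precomp φ χ := by
  obtain ⟨ψ, h₁, h₂⟩ := hφ
  refine Function.bijective_iff_has_inverse.2 ⟨fun χ => precomp ψ χ, fun χ => ?_, fun χ => ?_⟩
  · exact (precomp_precomp ψ φ χ).trans ((congrArg (fun t => precomp t χ) h₂).trans
      (precomp_one χ))
  · exact (precomp_precomp φ ψ χ).trans ((congrArg (fun t => precomp t χ) h₁).trans
      (precomp_one χ))

theorem IsLeftOpcartesian.comp_invertible {qs : Weight A B} {q q' : Loose A B}
    {ω : Cell (𝟙 B) qs (𝟙 A) q} (hω : IsLeftOpcartesian ω)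
    {φ : Cell (𝟙 B) (Chain.single q) (𝟙 A) q'} (hφ : IsInvertible φ) :
    IsLeftOpcartesian (gcomp ω φ) := by
  intro W S r g s
  refine (Function.bijective_iff_existsUnique fun χ => precomp (gcomp ω φ) χ).1 ?_
  have h : Function.Bijective fun χ : Cell (𝟙 B) (Chain.cons q r) g s => precomp ω χ :=
    (Function.bijective_iff_existsUnique _).2 (hω r g s)
  convert h.comp (precomp_bijective hφ) using 1
  funext χ
  exact (precomp_precomp ω φ χ).symm

theorem IsInvertible.symm {q q' : Loose A B} {φ : Cell (𝟙 B) (Chain.single q) (𝟙 A) q'}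
    (hφ : IsInvertible φ) : LooseIso q' q :=
  let ⟨ψ, h₁, h₂⟩ := hφ
  ⟨ψ, φ, h₂, h₁⟩

/-- Precomposition of a pairing with `one π` amounts to composition on the right. -/
theorem vcomp_pair_one {π : Loose E B} {p : Weight X E} {l l' : Loose X E} {q : Loose X B}
    (σ : Cell (𝟙 E) p (𝟙 X) l) (τ : Cell (𝟙 E) (Chain.single l) (𝟙 X) l')
    (ϖ : Cell (𝟙 B) (Chain.cons π (Chain.single l')) (𝟙 X) q) :
    vcomp (Row.cons (one π) (Row.single σ) rfl) (pair (one π) τ ϖ rfl) (Category.comp_id _)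
      (Category.comp_id _) = pair (one π) (gcomp σ τ) ϖ rfl := by
  have h := vcomp_pair (IsAppend.append (Row.single (one π)) (Row.single σ)) (one π) τ ϖ rfl rfl
    (Category.comp_id _) (Category.comp_id _) (Category.comp_id _)
  rwa [vcomp_one] at h

end

end VirtualDoubleCategory

namespace StrictVirtualEquipment

variable {Obj : Type u} [VirtualDoubleCategory.{u, v, w, z} Obj] [StrictVirtualEquipment Obj]

/-! ### Unit laws for loose-identities. -/

section

variable {B E V W X X' Y Y' Z Z' : Obj}

/-- 2-cells whose top contains a loose-identity agree if they agree after inserting its nullary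
2-cell. -/
theorem loId_ext {S T : Obj} (p : Weight B Z) (r : Weight W B) {f : Z ⟶ T} {g : W ⟶ S}
    {s : Loose S T} {χ χ' : Cell f (p.append (Chain.cons (loId B) r)) g s}
    (h : vcomp ((idRow p).append (Row.cons (loIdCell B) (idRow r) rfl)) χ
        (Category.id_comp f) (Category.id_comp g) =
      vcomp ((idRow p).append (Row.cons (loIdCell B) (idRow r) rfl)) χ'
        (Category.id_comp f) (Category.id_comp g)) : χ = χ' :=
  (isOpcartesian_loIdCell B p r f g s _).unique h rfl

theorem pair_leftUnitor (p : Loose X Y) :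
    pair (loIdCell Y) (one p) (leftUnitor p) rfl = one p :=
  (isOpcartesian_loIdCell Y (Chain.nil Y) (Chain.single p) (𝟙 Y) (𝟙 X) p (one p)).choose_spec.1

theorem pair_rightUnitor (p : Loose X Y) :
    pair (one p) (loIdCell X) (rightUnitor p) rfl = one p :=
  (isOpcartesian_loIdCell X (Chain.single p) (Chain.nil X) (𝟙 Y) (𝟙 X) p (one p)).choose_spec.1

theorem loIdCell_tightMap (g : X ⟶ X') :
    vcomp (Row.single (loIdCell X)) (tightMap g) (Category.id_comp g) (Category.id_comp g) =
      tightId g :=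
  (isOpcartesian_loIdCell X (Chain.nil X) (Chain.nil X) g g (loId X') (tightId g)).choose_spec.1

theorem tightId_pair {f : Z ⟶ B} {g : V ⟶ W} {p : Weight V Z} {q : Loose W B}
    (φ : Cell f p g q) : pair (tightId f) φ (leftUnitor q) rfl = φ := by
  have h := vcomp_pair (IsAppend.nil (Row.single φ)) (loIdCell B) (one q) (leftUnitor q) rfl rfl
    (Category.comp_id f) (Category.comp_id f) (Category.comp_id g)
  erw [pair_leftUnitor, vcomp_one'] at h
  exact h.symm

theorem pair_tightId {f : Z ⟶ B} {g : V ⟶ W} {p : Weight V Z} {q : Loose W B}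
    (φ : Cell f p g q) (h : p = p.append (Chain.nil V)) :
    pair φ (tightId g) (rightUnitor q) h = φ := by
  have h' := vcomp_pair (IsAppend.append_nil (Row.single φ)) (one q) (loIdCell W) (rightUnitor q)
    rfl h
    (Category.comp_id f) (Category.comp_id g) (Category.comp_id g)
  erw [pair_rightUnitor, vcomp_one'] at h'
  exact h'.symm

theorem tightId_id (X : Obj) : tightId (𝟙 X) = loIdCell X :=
  idRow_vcomp (loIdCell X) _ _

/-- Inserting the nullary 2-cell in both slots turns either side into `loIdCell X`. -/
theorem leftUnitor_loId (X : Obj) : leftUnitor (loId X) = rightUnitor (loId X) := by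
  refine loId_ext (Chain.nil X) (Chain.single (loId X)) ?_
  refine (pair_leftUnitor (loId X)).trans ?_
  refine loId_ext (Chain.nil X) (Chain.nil X) ?_
  refine (vcomp_one (loIdCell X)).trans ?_
  have h1 := vcomp_pair (IsAppend.nil (Row.single (loIdCell X))) (loIdCell X) (one (loId X))
    (rightUnitor (loId X)) rfl rfl (Category.comp_id _) (Category.comp_id _) (Category.comp_id _)
  have h2 := pair_tightId (loIdCell X) rfl
  erw [vcomp_one] at h1
  erw [tightId_id] at h2
  refine Eq.trans ?_ h1.symm
  refine h2.symm.trans ?_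
  exact congrArg (fun t => pair t (loIdCell X) (rightUnitor (loId X)) _) (tightId_id X).symm

theorem vcomp_nil_tightId (a : X ⟶ Y) (b : Y ⟶ Z) :
    vcomp (Row.nil a) (tightId b) rfl rfl = tightId (a ≫ b) :=
  IsPasting.vcomp_eq (IsPasting.nil rfl) _ _ _ _ _ _ _

theorem tightId_tightMap (f : X ⟶ Y) (g : Y ⟶ Z) :
    vcomp (Row.single (tightId f)) (tightMap g) rfl rfl = tightId (f ≫ g) := by
  have h := vcomp_vcomp (Row.nil f) (loIdCell Y) (tightMap g) (Category.id_comp g)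
    (Category.id_comp g) rfl rfl (Category.comp_id f) (Category.comp_id f) rfl rfl
  rw [loIdCell_tightMap, vcomp_nil_tightId] at h
  exact h

/-- Middle associativity of the actions of the unit. -/
theorem middle_unitor {π : Loose E B} {l : Loose W E} {q : Loose W B}
    (ϖ : Cell (𝟙 B) (Chain.cons π (Chain.single l)) (𝟙 W) q) :
    vcomp (Row.cons (rightUnitor π) (Row.single (one l)) rfl) ϖ (Category.comp_id _)
        (Category.comp_id _) =
      vcomp (Row.cons (one π) (Row.single (leftUnitor l)) rfl) ϖ (Category.comp_id _)
        (Category.comp_id _) := by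
  refine loId_ext (Chain.single π) (Chain.single l) ?_
  have h1 := vcomp_pair (IsAppend.append (Row.cons (one π) (Row.single (loIdCell E)) rfl)
    (Row.single (one l))) (rightUnitor π) (one l) ϖ rfl rfl (Category.comp_id _) (Category.comp_id _)
      (Category.comp_id _)
  have h2 := vcomp_pair (IsAppend.append (Row.single (one π))
    (Row.cons (loIdCell E) (Row.single (one l)) rfl)) (one π) (leftUnitor l) ϖ rfl rfl
      (Category.comp_id _) (Category.comp_id _) (Category.comp_id _)
  erw [vcomp_one, show vcomp (Row.cons (one π) (Row.single (loIdCell E)) _) _ _ _ = one π from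
    pair_rightUnitor π] at h1
  erw [vcomp_one, show vcomp (Row.cons (loIdCell E) (Row.single (one l)) _) _ _ _ = one l from
    pair_leftUnitor l] at h2
  exact h1.trans h2.symm

/-- Both sides become `ϖ` once the nullary 2-cell of `W(1, 1)` is inserted on the right. -/
theorem right_unitor_naturality {π : Loose E B} {l : Loose W E} {q : Loose W B}
    (ϖ : Cell (𝟙 B) (Chain.cons π (Chain.single l)) (𝟙 W) q) :
    vcomp (Row.cons ϖ (Row.single (one (loId W))) rfl) (rightUnitor q) (Category.comp_id _)
        (Category.comp_id _) =
      vcomp (Row.cons (one π) (Row.single (rightUnitor l)) rfl) ϖ (Category.comp_id _)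
        (Category.comp_id _) := by
  refine loId_ext (Chain.cons π (Chain.single l)) (Chain.nil W) ?_
  have h1 := vcomp_pair (IsAppend.append (idRow (Chain.cons π (Chain.single l)))
    (Row.single (loIdCell W))) ϖ (one (loId W)) (rightUnitor q) rfl rfl
      (Category.id_comp _) (Category.id_comp _) (Category.comp_id _)
  have h2 := vcomp_pair (IsAppend.append (Row.single (one π))
    (Row.cons (one l) (Row.single (loIdCell W)) rfl)) (one π) (rightUnitor l) ϖ rfl rfl
      (Category.comp_id _) (Category.comp_id _) (Category.comp_id _)
  erw [vcomp_one, idRow_vcomp] at h1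
  erw [vcomp_one, show vcomp (Row.cons (one l) (Row.single (loIdCell W)) _) _ _ _ = one l from
    pair_rightUnitor l] at h2
  refine Eq.trans ?_ h2.symm
  refine h1.trans ?_
  refine Eq.trans ?_ (idRow_vcomp ϖ (Category.comp_id _) (Category.comp_id _)).symm
  rw [← tightId_id]
  exact pair_tightId ϖ _

theorem tightMap_pair_naturality {B' : Obj} {a : B ⟶ B'} {b : W ⟶ X'} {q : Loose W B}
    {q' : Loose X' B'} (ψ : Cell a (Chain.single q) b q') :
    vcomp (Row.cons (tightMap a) (Row.single ψ) rfl) (leftUnitor q') (Category.comp_id _)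
        (Category.comp_id _) =
      vcomp (Row.single (leftUnitor q)) ψ (Category.id_comp _) (Category.id_comp _) := by
  refine loId_ext (Chain.nil B) (Chain.single q) ?_
  have h1 := vcomp_pair (IsAppend.append (Row.single (loIdCell B)) (idRow (Chain.single q)))
    (tightMap a) ψ (leftUnitor q') rfl rfl
      (Category.id_comp _) (Category.id_comp _) (Category.id_comp _)
  have h2 := vcomp_vcomp (Row.cons (loIdCell B) (Row.single (one q)) rfl) (leftUnitor q) ψ
    (Category.id_comp _) (Category.id_comp _) (Category.id_comp _) (Category.id_comp _)
    (Category.comp_id _) (Category.comp_id _) (Category.id_comp _) (Category.id_comp _)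
  rw [loIdCell_tightMap, idRow_vcomp] at h1
  erw [show vcomp (Row.cons (loIdCell B) (Row.single (one q)) _) _ _ _ = one q from
    pair_leftUnitor q] at h2
  refine h1.trans ((tightId_pair ψ).trans ?_)
  exact (idRow_vcomp ψ (Category.id_comp _) (Category.id_comp _)).symm.trans h2

theorem pair_tightMap_naturality {B' : Obj} {a : B ⟶ B'} {b : W ⟶ X'} {q : Loose W B}
    {q' : Loose X' B'} (ψ : Cell a (Chain.single q) b q') :
    vcomp (Row.cons ψ (Row.single (tightMap b)) rfl) (rightUnitor q') (Category.comp_id _)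
        (Category.comp_id _) =
      vcomp (Row.single (rightUnitor q)) ψ (Category.id_comp _) (Category.id_comp _) := by
  refine loId_ext (Chain.single q) (Chain.nil W) ?_
  have h1 := vcomp_pair (IsAppend.append (idRow (Chain.single q)) (Row.single (loIdCell W)))
    ψ (tightMap b) (rightUnitor q') rfl rfl
      (Category.id_comp _) (Category.id_comp _) (Category.id_comp _)
  have h2 := vcomp_vcomp (Row.cons (one q) (Row.single (loIdCell W)) rfl) (rightUnitor q) ψ
    (Category.id_comp _) (Category.id_comp _) (Category.id_comp _) (Category.id_comp _)
    (Category.comp_id _) (Category.comp_id _) (Category.id_comp _) (Category.id_comp _)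
  rw [loIdCell_tightMap, idRow_vcomp] at h1
  erw [show vcomp (Row.cons (one q) (Row.single (loIdCell W)) _) _ _ _ = one q from
    pair_rightUnitor q] at h2
  refine h1.trans ((pair_tightId ψ _).trans ?_)
  exact (idRow_vcomp ψ (Category.id_comp _) (Category.id_comp _)).symm.trans h2

section

variable {f : Z ⟶ B} {c : Y ⟶ E} {k : V ⟶ W} {p : Weight Y Z} {r : Weight V Y} {π : Loose E B}
  {l : Loose W E} {q : Loose W B} {ps : Weight V Z}

/-- Obtained by placing the row `(ρ, κ, φ)` above `middle_unitor`. This associativity makes pairing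
with a composite the composite of two pairings, which underlies two-out-of-three. -/
theorem pair_pair_middle {d : X ⟶ E} {p₁ : Weight X Y} {r₁ : Weight V X} {ps₁ : Weight X Z}
    {ps₂ : Weight V Y}
    (ρ : Cell f p c π) (κ : Cell c p₁ d (loId E)) (φ : Cell d r₁ k l)
    (ϖ : Cell (𝟙 B) (Chain.cons π (Chain.single l)) (𝟙 W) q) (h₁ : ps₁ = p.append p₁)
    (h₂ : ps = ps₁.append r₁) (h₃ : ps₂ = p₁.append r₁) (h₄ : ps = p.append ps₂) :
    pair (pair ρ κ (rightUnitor π) h₁) φ ϖ h₂ = pair ρ (pair κ φ (leftUnitor l) h₃) ϖ h₄ := by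
  have H₁ : IsAppend (Row.cons ρ (Row.single κ) h₁) (Row.single φ)
      (Row.cons ρ (Row.cons κ (Row.single φ) h₃) h₄) :=
    IsAppend.cons _ _ _ (IsAppend.cons _ _ _ (IsAppend.nil _))
  have H₂ : IsAppend (Row.single ρ) (Row.cons κ (Row.single φ) h₃)
      (Row.cons ρ (Row.cons κ (Row.single φ) h₃) h₄) :=
    IsAppend.cons _ _ _ (IsAppend.nil _)
  have h1 := vcomp_pair H₁ (rightUnitor π) (one l) ϖ rfl h₂ (Category.comp_id _)
    (Category.comp_id _) (Category.comp_id _)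
  have h2 := vcomp_pair H₂ (one π) (leftUnitor l) ϖ rfl h₄ (Category.comp_id _)
    (Category.comp_id _) (Category.comp_id _)
  rw [vcomp_one] at h1 h2
  exact h1.symm.trans ((congrArg (fun t => vcomp _ t _ _) (middle_unitor ϖ)).trans h2)

theorem pair_pair_right {d : X ⟶ W} {p₁ : Weight X Y} {r₁ : Weight V X} {ps₁ : Weight X Z}
    {ps₂ : Weight V Y}
    (ρ : Cell f p c π) (φ : Cell c p₁ d l) (β : Cell d r₁ k (loId W))
    (ϖ : Cell (𝟙 B) (Chain.cons π (Chain.single l)) (𝟙 W) q) (h₁ : ps₁ = p.append p₁)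
    (h₂ : ps = ps₁.append r₁) (h₃ : ps₂ = p₁.append r₁) (h₄ : ps = p.append ps₂) :
    pair (pair ρ φ ϖ h₁) β (rightUnitor q) h₂ = pair ρ (pair φ β (rightUnitor l) h₃) ϖ h₄ := by
  have H₁ : IsAppend (Row.cons ρ (Row.single φ) h₁) (Row.single β)
      (Row.cons ρ (Row.cons φ (Row.single β) h₃) h₄) :=
    IsAppend.cons _ _ _ (IsAppend.cons _ _ _ (IsAppend.nil _))
  have H₂ : IsAppend (Row.single ρ) (Row.cons φ (Row.single β) h₃)
      (Row.cons ρ (Row.cons φ (Row.single β) h₃) h₄) :=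
    IsAppend.cons _ _ _ (IsAppend.nil _)
  have h1 := vcomp_pair H₁ ϖ (one (loId W)) (rightUnitor q) rfl h₂ (Category.comp_id _)
    (Category.comp_id _) (Category.comp_id _)
  have h2 := vcomp_pair H₂ (one π) (rightUnitor l) ϖ rfl h₄ (Category.comp_id _)
    (Category.comp_id _) (Category.comp_id _)
  rw [vcomp_one] at h1 h2
  exact h1.symm.trans ((congrArg (fun t => vcomp _ t _ _) (right_unitor_naturality ϖ)).trans h2)

/-- The action of the unit is natural in 2-cells with arbitrary sides. -/
theorem pair_tightMap_left {B' W' : Obj} {c : Y ⟶ B}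
    {m : Loose W B} (α : Cell f p c (loId B)) (φ : Cell c r k m) {a : B ⟶ B'} {b : W ⟶ W'}
    {m' : Loose W' B'} (ψ : Cell a (Chain.single m) b m') (h : ps = p.append r)
    {fa : Z ⟶ B'} {ca : Y ⟶ B'} {kb : V ⟶ W'} (e : f ≫ a = fa) (e₁ : c ≫ a = ca)
    (e₂ : k ≫ b = kb) :
    pair (vcomp (Row.single α) (tightMap a) e e₁) (vcomp (Row.single φ) ψ e₁ e₂)
        (leftUnitor m') h =
      vcomp (Row.single (pair α φ (leftUnitor m) h)) ψ e e₂ := by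
  have H₁ : IsAppend (Row.single α) (Row.single φ) (Row.cons α (Row.single φ) h) :=
    IsAppend.cons _ _ _ (IsAppend.nil _)
  have h1 := vcomp_pair H₁ (tightMap a) ψ (leftUnitor m') rfl h e e₁ e₂
  rw [pair_vcomp, ← h1]
  exact congrArg (fun t => vcomp _ t _ _) (tightMap_pair_naturality ψ)

theorem pair_tightMap_right {B' W' : Obj} {d : Y ⟶ W} (φ : Cell f p d q) (α : Cell d r k (loId W))
    {a : B ⟶ B'} {b : W ⟶ W'}
    {m' : Loose W' B'} (ψ : Cell a (Chain.single q) b m') (h : ps = p.append r)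
    {fa : Z ⟶ B'} {db : Y ⟶ W'} {kb : V ⟶ W'} (e : f ≫ a = fa) (e₁ : d ≫ b = db)
    (e₂ : k ≫ b = kb) :
    pair (vcomp (Row.single φ) ψ e e₁) (vcomp (Row.single α) (tightMap b) e₁ e₂)
        (rightUnitor m') h =
      vcomp (Row.single (pair φ α (rightUnitor q) h)) ψ e e₂ := by
  have H₁ : IsAppend (Row.single φ) (Row.single α) (Row.cons φ (Row.single α) h) :=
    IsAppend.cons _ _ _ (IsAppend.nil _)
  have h1 := vcomp_pair H₁ ψ (tightMap b) (rightUnitor m') rfl h e e₁ e₂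
  rw [pair_vcomp, ← h1]
  exact congrArg (fun t => vcomp _ t _ _) (pair_tightMap_naturality ψ)

end

end

/-! ### Chosen restrictions, companions and conjoints. -/

section

variable {A A' B B' D D' W W' : Obj}

theorem factor_cart {q : Loose B' B} {f : A ⟶ B} {f' : A' ⟶ B'}
    {g : W ⟶ A} {g' : W' ⟶ A'} {r : Weight W' W} {k : W ⟶ B} {k' : W' ⟶ B'}
    (φ : Cell k r k' q) (hk : g ≫ f = k) (hk' : g' ≫ f' = k') :
    vcomp (Row.single (factor φ hk hk')) (cart q f f') hk hk' = φ := by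
  subst hk hk'
  exact (isCartesian_cart q f f' g g' r φ).choose_spec.1

theorem cart_ext {q : Loose B' B} {f : A ⟶ B} {f' : A' ⟶ B'}
    {g : W ⟶ A} {g' : W' ⟶ A'} {r : Weight W' W} {k : W ⟶ B} {k' : W' ⟶ B'}
    {φ φ' : Cell g r g' (restr q f f')} (hk : g ≫ f = k) (hk' : g' ≫ f' = k')
    (h : vcomp (Row.single φ) (cart q f f') hk hk' =
      vcomp (Row.single φ') (cart q f f') hk hk') : φ = φ' := by
  subst hk hk'
  exact (isCartesian_cart q f f' g g' r _).unique h rfl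

theorem factor_bijective {q : Loose B' B} {f : A ⟶ B} {f' : A' ⟶ B'}
    {g : W ⟶ A} {g' : W' ⟶ A'} {r : Weight W' W} {k : W ⟶ B} {k' : W' ⟶ B'}
    (hk : g ≫ f = k) (hk' : g' ≫ f' = k') :
    Function.Bijective fun φ : Cell g r g' (restr q f f') =>
      vcomp (Row.single φ) (cart q f f') hk hk' :=
  ⟨fun _ _ h => cart_ext hk hk' h, fun φ => ⟨factor φ hk hk', factor_cart φ hk hk'⟩⟩

theorem conjointUnit_cart (j : A ⟶ B) :
    vcomp (Row.single (conjointUnit j)) (cart (loId B) j (𝟙 B)) (Category.id_comp j)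
      (Category.comp_id j) = tightId j :=
  factor_cart _ _ _

/-- The universal 2-cell of the companion `E(1, j)`. -/
noncomputable def companionUnit (j : A ⟶ B) :
    Cell j (Chain.nil A) (𝟙 A) (hom (𝟙 B) j) :=
  factor (tightId j) (Category.comp_id j) (Category.id_comp j)

theorem companionUnit_cart (j : A ⟶ B) :
    vcomp (Row.single (companionUnit j)) (cart (loId B) (𝟙 B) j) (Category.comp_id j)
      (Category.id_comp j) = tightId j :=
  factor_cart _ _ _

/-- The row of identity 2-cells on a chain, followed by the universal 2-cell of a conjoint. -/
noncomputable def conjointRow (g : A ⟶ B) : ∀ {Y : Obj} (r : Weight A Y),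
    Row Cell (𝟙 Y) r g (r.append (Chain.single (hom g (𝟙 B))))
  | _, Chain.nil _ => Row.single (conjointUnit g)
  | _, Chain.cons p r => Row.cons (one p) (conjointRow g r) rfl

theorem isAppend_conjointRow (g : A ⟶ B) {Y : Obj} (r : Weight A Y) :
    IsAppend (idRow r) (Row.single (conjointUnit g)) (conjointRow g r) := by
  induction r with
  | nil => exact IsAppend.nil _
  | cons p r ih => exact IsAppend.cons _ _ _ ih

theorem isAppend_append_conjointRow (g : A ⟶ B) {Y Z : Obj} (p : Weight Y Z) (r : Weight A Y) :
    IsAppend (idRow (p.append r)) (Row.single (conjointUnit g))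
      ((idRow p).append (conjointRow g r)) := by
  induction p with
  | nil => exact isAppend_conjointRow g r
  | cons p ps ih => exact IsAppend.cons _ _ _ ih

end

/-! ### Lifting 2-cells and their stability properties. -/

section

variable {B E V W X Y Z : Obj} {f : Z ⟶ B} {c : Y ⟶ E} {p : Weight Y Z} {π : Loose E B}
  {l : Loose W E} {q : Loose W B}

/-- A 2-cell with right side `g` is recovered from the corresponding 2-cell out of `r, W(g, 1)` with
identity right side by inserting the conjoint unit. -/
theorem conjointRow_pair {r : Weight V Y} {g : V ⟶ W} (φ : Cell c r g l) :
    vcomp (conjointRow g r) (pair φ (cart (loId W) g (𝟙 W)) (rightUnitor l) rfl)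
      (Category.id_comp c) (Category.comp_id g) = φ := by
  have h := vcomp_pair (isAppend_conjointRow g r) φ (cart (loId W) g (𝟙 W)) (rightUnitor l) rfl
    (Chain.append_nil _).symm (Category.id_comp c) (Category.id_comp g) (Category.comp_id g)
  rw [idRow_vcomp, conjointUnit_cart, pair_tightId] at h
  exact h

/-- Composition with `κ` and `ϖ` is a bijection between 2-cells `r ⇒ l` with left side the right
side of `κ`, and 2-cells `p, r ⇒ q` with left side the left side of `κ`. -/
def Lifts (κ : Cell f p c π) (ϖ : Cell (𝟙 B) (Chain.cons π (Chain.single l)) (𝟙 W) q) : Prop :=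
  ∀ ⦃V : Obj⦄ ⦃r : Weight V Y⦄ ⦃g : V ⟶ W⦄ ⦃ps : Weight V Z⦄ (h : ps = p.append r),
    Function.Bijective fun φ : Cell c r g l => pair κ φ ϖ h

/-- Right lifts are tested only on 2-cells with identity right side. A right side `g` is absorbed by
appending `W(g, 1)` to the top, and the conjoint unit brings it back. -/
theorem Lifts.of_id {κ : Cell f p c π}
    {ϖ : Cell (𝟙 B) (Chain.cons π (Chain.single l)) (𝟙 W) q}
    (H : ∀ r : Weight W Y, Function.Bijective fun φ : Cell c r (𝟙 W) l => pair κ φ ϖ rfl) :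
    Lifts κ ϖ := by
  rintro V r g _ rfl
  constructor
  · intro φ φ' h
    rw [← conjointRow_pair φ, ← conjointRow_pair φ']
    congr 1
    refine (H _).1 ?_
    have e := pair_pair_right κ φ (cart (loId W) g (𝟙 W)) ϖ rfl
      (Chain.append_assoc p r (Chain.single (hom g (𝟙 W)))).symm rfl rfl
    have e' := pair_pair_right κ φ' (cart (loId W) g (𝟙 W)) ϖ rfl
      (Chain.append_assoc p r (Chain.single (hom g (𝟙 W)))).symm rfl rfl
    refine e.symm.trans (Eq.trans ?_ e')
    exact congrArg (fun t => pair t _ _ _) h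
  · intro χ
    obtain ⟨ψ, hψ⟩ := (H (r.append (Chain.single (hom g (𝟙 W))))).2
      (pair χ (cart (loId W) g (𝟙 W)) (rightUnitor q)
        (Chain.append_assoc p r (Chain.single (hom g (𝟙 W)))).symm)
    refine ⟨vcomp (conjointRow g r) ψ (Category.id_comp c) (Category.comp_id g), ?_⟩
    have e := vcomp_pair (IsAppend.append (idRow p) (conjointRow g r)) κ ψ ϖ rfl rfl
      (Category.id_comp _) (Category.id_comp _) (Category.comp_id _)
    have e' := vcomp_pair (isAppend_append_conjointRow g p r) χ (cart (loId W) g (𝟙 W))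
      (rightUnitor q) (Chain.append_assoc p r (Chain.single (hom g (𝟙 W)))).symm
      (Chain.append_nil _).symm (Category.id_comp _) (Category.id_comp _) (Category.comp_id _)
    rw [idRow_vcomp] at e
    rw [idRow_vcomp, conjointUnit_cart, pair_tightId] at e'
    refine e.symm.trans (Eq.trans ?_ e')
    exact congrArg (fun t => vcomp _ t _ _) hψ

theorem lifts_one_iff {ϖ : Cell (𝟙 B) (Chain.cons π (Chain.single l)) (𝟙 W) q} :
    Lifts (one π) ϖ ↔ IsRightLift (p := Chain.single π) ϖ :=
  ⟨fun H _ φ => (H rfl).existsUnique φ,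
    fun H => Lifts.of_id fun r => (Function.bijective_iff_existsUnique _).2 (H r)⟩

/-- A left side `c` is traded for the companion `E(1, c)` at the start of the top, and `π, E(1, c)`
is compared with `π(1, c)`. -/
theorem lifts_cart {ϖ : Cell (𝟙 B) (Chain.cons π (Chain.single l)) (𝟙 W) q}
    (H : Lifts (one π) ϖ) (c : Y ⟶ E) : Lifts (cart π (𝟙 B) c) ϖ := by
  -- `α : π, E(1, c) ⇒ π(1, c)` is the canonical comparison; only its composite with the cartesian
  -- 2-cell matters.
  have hα := factor_cart (pair (one π) (cart (loId E) (𝟙 E) c)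
    (rightUnitor π) rfl) (Category.id_comp (𝟙 B)) (Category.id_comp c)
  generalize factor (pair (one π) (cart (loId E) (𝟙 E) c)
    (rightUnitor π) rfl) (Category.id_comp (𝟙 B)) (Category.id_comp c) = α at hα
  rintro V r g _ rfl
  constructor
  · intro φ φ' h
    have key : ∀ φ : Cell c r g l,
        vcomp (Row.cons (companionUnit c) (idRow r) rfl)
          (pair (cart (loId E) (𝟙 E) c) φ (leftUnitor l) rfl)
          (Category.comp_id c) (Category.id_comp g) = φ := by
      intro φ
      have e := vcomp_pair (IsAppend.append (Row.single (companionUnit c)) (idRow r))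
        (cart (loId E) (𝟙 E) c) φ (leftUnitor l) rfl rfl
        (Category.comp_id c) (Category.id_comp c) (Category.id_comp g)
      rw [idRow_vcomp, companionUnit_cart, tightId_pair] at e
      exact e
    have key' : ∀ φ : Cell c r g l,
        pair (one π) (pair (cart (loId E) (𝟙 E) c) φ (leftUnitor l) rfl)
          ϖ rfl =
        vcomp (Row.cons α (idRow r) rfl) (pair (cart π (𝟙 B) c) φ ϖ rfl)
          (Category.id_comp _) (Category.id_comp _) := by
      intro φ
      have e := vcomp_pair (IsAppend.append (Row.single α) (idRow r))
        (cart π (𝟙 B) c) φ ϖ rfl rfl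
        (Category.id_comp _) (Category.id_comp _) (Category.id_comp g)
      rw [idRow_vcomp, hα] at e
      refine Eq.trans ?_ e.symm
      exact (pair_pair_middle _ _ _ _ _ _ _ _).symm
    rw [← key φ, ← key φ']
    congr 1
    refine (H rfl).1 ?_
    refine (key' φ).trans (Eq.trans ?_ (key' φ').symm)
    exact congrArg (fun t => vcomp _ t _ _) h
  · intro χ
    obtain ⟨ψ, hψ⟩ := (H rfl).2 (vcomp (Row.cons α (idRow r) rfl) χ
          (Category.id_comp _) (Category.id_comp _))
    refine ⟨vcomp (Row.cons (companionUnit c) (idRow r) rfl) ψ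
          (Category.comp_id c) (Category.id_comp g), ?_⟩
    have e := vcomp_pair (IsAppend.append (Row.single (cart π (𝟙 B) c))
      (Row.cons (companionUnit c) (idRow r) rfl)) (one π) ψ ϖ rfl rfl
        (Category.comp_id _) (Category.comp_id _) (Category.id_comp g)
    rw [vcomp_one] at e
    refine e.symm.trans ?_
    refine (congrArg (fun t => vcomp _ t _ _) hψ).trans ?_
    -- Triangle identity: `α` undoes the row formed by the cartesian 2-cell and the companion unit.
    -- Surjectivity follows from it.
    have hu : vcomp (Row.cons (cart π (𝟙 B) c)
        (Row.single (companionUnit c)) rfl) α (Category.comp_id _) (Category.id_comp _) =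
        one (restr π (𝟙 B) c) := by
      refine cart_ext (Category.comp_id _) (Category.id_comp _) ?_
      have e1 := vcomp_pair (IsAppend.append (Row.single (cart π (𝟙 B) c))
        (Row.single (companionUnit c))) (one π) (cart (loId E) (𝟙 E) c)
        (rightUnitor π) rfl rfl
        (Category.comp_id _) (Category.comp_id _) (Category.id_comp c)
      rw [vcomp_one, companionUnit_cart] at e1
      refine (vcomp_vcomp _ _ _ (Category.id_comp _) (Category.id_comp _) (Category.id_comp _)
        (Category.id_comp _) _ _ _ _).trans ?_
      refine (congrArg (fun t => vcomp _ t _ _) hα).trans (e1.trans ?_)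
      exact (pair_tightId _ _).trans (idRow_vcomp _ _ _).symm
    have e2 := IsPasting.cons α (Category.comp_id _) (Category.id_comp _) rfl rfl
      (IsAppend.append (Row.cons (cart π (𝟙 B) c)
        (Row.single (companionUnit c)) rfl) (idRow r)) (IsPasting.idRow_left (idRow r))
    refine (IsPasting.vcomp_eq e2 χ (Category.id_comp _) (Category.id_comp _) (Category.id_comp _)
        (Category.id_comp _) (Category.id_comp _) (Category.id_comp _)).trans ?_
    exact (congrArg (fun t => vcomp (Row.cons t (idRow r) rfl) χ (Category.id_comp _)
      (Category.id_comp _)) hu).trans (idRow_vcomp χ _ _)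

end

section

variable {B E V W X X' Y Z : Obj} {f : Z ⟶ B} {c : Y ⟶ E} {p : Weight Y Z} {π : Loose E B}
  {l l' : Loose W E} {q : Loose W B}

theorem isLeftOpcartesian_loIdCell (X : Obj) : IsLeftOpcartesian (loIdCell X) :=
  fun _ _ r g s φ => isOpcartesian_loIdCell X (Chain.nil X) r (𝟙 X) g s φ

omit [StrictVirtualEquipment Obj] in
-- Pairing with the composite is pairing with `κ` followed by `precomp ω`, and both are bijective.
-- Left-opcartesianness only tests 2-cells with identity left side, hence the left side of `κ`.
theorem Lifts.leftOpcartesian {qs : Weight Y B} {m : Loose Y B} {ω : Cell (𝟙 B) qs (𝟙 Y) m}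
    (hω : IsLeftOpcartesian ω) {κ : Cell (𝟙 B) (Chain.single m) c π}
    {ϖ : Cell (𝟙 B) (Chain.cons π (Chain.single l)) (𝟙 W) q} (H : Lifts κ ϖ) :
    Lifts (vcomp (Row.single ω) κ (Category.id_comp _) (Category.id_comp c)) ϖ := by
  rintro V r g _ rfl
  have h : Function.Bijective fun χ : Cell (𝟙 B) (Chain.cons m r) g q => precomp ω χ :=
    (Function.bijective_iff_existsUnique _).2 (hω r g q)
  exact Eq.mp (congrArg Function.Bijective (funext fun φ => precomp_pair ω κ φ ϖ))
    (h.comp (H rfl))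

omit [StrictVirtualEquipment Obj] in
theorem Lifts.invertible {m m' : Loose Y Z} {u : Cell (𝟙 Z) (Chain.single m) (𝟙 Y) m'}
    (hu : IsInvertible u) {κ : Cell f (Chain.single m') c π}
    {ϖ : Cell (𝟙 B) (Chain.cons π (Chain.single l)) (𝟙 W) q} (H : Lifts κ ϖ) :
    Lifts (vcomp (Row.single u) κ (Category.id_comp _) (Category.id_comp c)) ϖ := by
  rintro V r g _ rfl
  exact Eq.mp (congrArg Function.Bijective (funext fun φ => precomp_pair u κ φ ϖ))
    ((precomp_bijective hu).comp (H rfl))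

/-- Two-out-of-three for lifting 2-cells, along middle associativity. -/
theorem Lifts.pair_iff {X : Obj} {d : X ⟶ E} {p₁ : Weight X Y} {ps : Weight X Z}
    {ρ : Cell f p c π} {κ : Cell c p₁ d (loId E)}
    {ϖ : Cell (𝟙 B) (Chain.cons π (Chain.single l)) (𝟙 W) q} (H : Lifts ρ ϖ)
    (h : ps = p.append p₁) :
    Lifts (pair ρ κ (rightUnitor π) h) ϖ ↔ Lifts κ (leftUnitor l) := by
  subst h
  have key : ∀ {V : Obj} {r : Weight V X} {g : V ⟶ W},
      (fun φ : Cell d r g l => pair (pair ρ κ (rightUnitor π) rfl) φ ϖ rfl) =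
      (fun φ => pair ρ φ ϖ (Chain.append_assoc _ _ _)) ∘ fun φ => pair κ φ (leftUnitor l) rfl :=
    funext fun φ => pair_pair_middle _ _ _ _ _ _ _ _
  constructor
  · rintro H' V r g _ rfl
    have := H' (r := r) (g := g) rfl
    rw [key] at this
    exact (Function.Bijective.of_comp_iff' (H _) _).1 this
  · rintro H' V r g _ rfl
    rw [key]
    exact (H _).comp (H' rfl)

theorem Lifts.tight_pair_iff {X : Obj} {d : X ⟶ E} {f : Z ⟶ E} {p₁ : Weight X Y} {ps : Weight X Z}
    {ρ : Cell f p c (loId E)} {κ : Cell c p₁ d (loId E)} (H : Lifts ρ (leftUnitor l))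
    (h : ps = p.append p₁) :
    Lifts (pair ρ κ (leftUnitor (loId E)) h) (leftUnitor l) ↔ Lifts κ (leftUnitor l) := by
  rw [leftUnitor_loId]
  exact H.pair_iff h

/-- Pairing with the inverse of `σ` inverts pairing with `σ`. -/
theorem lifts_of_isTightInvertible {f g : Z ⟶ E} {σ : TightCell f g} (hσ : IsTightInvertible σ)
    (l : Loose W E) : Lifts σ (leftUnitor l) := by
  obtain ⟨τ, h₁, h₂⟩ := hσ
  intro V r k ps h
  have h' : ps = r := h
  subst h'
  change pair σ τ _ rfl = _ at h₁
  change pair τ σ _ rfl = _ at h₂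
  rw [leftUnitor_loId] at h₁ h₂
  refine Function.bijective_iff_has_inverse.2 ⟨fun φ => pair τ φ (leftUnitor l) rfl,
    fun φ => ?_, fun φ => ?_⟩
  · refine (pair_pair_middle τ σ φ (leftUnitor l) rfl rfl rfl rfl).symm.trans ?_
    rw [h₂]
    exact tightId_pair φ
  · refine (pair_pair_middle σ τ φ (leftUnitor l) rfl rfl rfl rfl).symm.trans ?_
    rw [h₁]
    exact tightId_pair φ

/-- A Yoneda argument: the inverse is the preimage of the identity of `f`, and the other inverse law
follows from injectivity. -/
theorem Lifts.isTightInvertible {f g : Z ⟶ E} {σ : TightCell f g}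
    (H : Lifts σ (leftUnitor (loId E))) : IsTightInvertible σ := by
  obtain ⟨τ, hτ⟩ := (H (r := Chain.nil Z) (g := f) rfl).2 (tightId f)
  refine ⟨τ, hτ, (H (r := Chain.nil Z) (g := g) rfl).1 ?_⟩
  change pair σ (pair τ σ _ rfl) _ _ = pair σ (tightId g) _ _
  change pair σ τ _ _ = _ at hτ
  refine (pair_pair_middle σ τ σ (leftUnitor (loId E)) rfl rfl rfl rfl).symm.trans ?_
  rw [← leftUnitor_loId, hτ]
  refine (tightId_pair σ).trans ?_
  rw [leftUnitor_loId]
  exact (pair_tightId σ _).symm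

omit [StrictVirtualEquipment Obj] in
-- Two right lifts of the same loose-cell through `π` are related by mutually inverse comparisons.
theorem Lifts.isInvertible {ϖ : Cell (𝟙 B) (Chain.cons π (Chain.single l)) (𝟙 W) q}
    {ϖ' : Cell (𝟙 B) (Chain.cons π (Chain.single l')) (𝟙 W) q} (H : Lifts (one π) ϖ)
    (H' : Lifts (one π) ϖ') {σ : Cell (𝟙 E) (Chain.single l) (𝟙 W) l'}
    (hσ : pair (one π) σ ϖ' rfl = ϖ) : IsInvertible σ := by
  obtain ⟨τ, hτ⟩ := (H (r := Chain.single l') (g := 𝟙 W) rfl).2 ϖ'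
  change pair (one π) τ ϖ _ = _ at hτ
  have h1 : ∀ {l : Loose W E} (ϖ : Cell (𝟙 B) (Chain.cons π (Chain.single l)) (𝟙 W) q),
      pair (one π) (one l) ϖ rfl = ϖ := fun ϖ => idRow_vcomp ϖ _ _
  refine ⟨τ, (H (r := Chain.single l) (g := 𝟙 W) rfl).1 ?_,
    (H' (r := Chain.single l') (g := 𝟙 W) rfl).1 ?_⟩
  · refine (vcomp_pair_one σ τ ϖ).symm.trans ?_
    refine Eq.trans ?_ (h1 ϖ).symm
    exact (congrArg (fun t => vcomp _ t _ _) hτ).trans hσ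
  · refine (vcomp_pair_one τ σ ϖ').symm.trans ?_
    refine Eq.trans ?_ (h1 ϖ').symm
    exact (congrArg (fun t => vcomp _ t _ _) hσ).trans hτ

end

/-! ### Colimits, respect and preservation in terms of lifting 2-cells. -/

section

variable {W X X' Y Z : Obj} {p : Weight Y Z} {f : Z ⟶ X}

theorem Cocone.act_cart (γ : Cocone p f) (q : Loose W X) {r : Weight W Y}
    (ψ : Cell (𝟙 Y) r (𝟙 W) (restr q γ.pt (𝟙 W))) :
    vcomp (Row.single (vcomp ((idRow p).append (Row.single ψ)) (γ.act q) (Category.id_comp _)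
        (Category.id_comp _))) (cart q f (𝟙 W)) (Category.id_comp f) (Category.comp_id _) =
      pair γ.legCell (vcomp (Row.single ψ) (cart q γ.pt (𝟙 W)) (Category.id_comp _)
        (Category.comp_id _)) (leftUnitor q) rfl := by
  have h := vcomp_pair (IsAppend.append (idRow p) (Row.single ψ)) γ.legCell (cart q γ.pt (𝟙 W))
    (leftUnitor q) rfl rfl (Category.id_comp _) (Category.id_comp _) (Category.comp_id _)
  rw [idRow_vcomp] at h
  refine Eq.trans ?_ h
  refine (vcomp_vcomp _ _ _ (Category.id_comp _) (Category.comp_id _) (Category.id_comp _)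
    (Category.comp_id _) _ _ _ _).trans ?_
  exact congrArg (fun t => vcomp _ t _ _) (factor_cart _ _ _)

/-- The cartesian 2-cells of `q(c, 1)` and `q(f, 1)` identify the globular 2-cells tested by a right
lift with 2-cells into `q` having sides `c` and `f`. `Lifts.of_id` supplies the remaining right
sides. -/
theorem respects_iff {q : Loose W X} {γ : Cocone p f} :
    Respects q γ ↔ Lifts γ.legCell (leftUnitor q) := by
  have key : ∀ r : Weight W Y,
      (∀ φ : Cell (𝟙 Z) (p.append r) (𝟙 W) (restr q f (𝟙 W)),
        ∃! ψ : Cell (𝟙 Y) r (𝟙 W) (restr q γ.pt (𝟙 W)),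
          vcomp ((idRow p).append (Row.single ψ)) (γ.act q) (Category.id_comp _)
            (Category.id_comp _) = φ) ↔
      Function.Bijective fun φ : Cell γ.pt r (𝟙 W) q =>
        pair γ.legCell φ (leftUnitor q) rfl := by
    intro r
    rw [← Function.bijective_iff_existsUnique,
      ← Function.Bijective.of_comp_iff' (factor_bijective (q := q) (f := f) (f' := 𝟙 W)
        (g := 𝟙 Z) (g' := 𝟙 W) (Category.id_comp f) (Category.comp_id _)),
      ← Function.Bijective.of_comp_iff _ (factor_bijective (q := q) (f := γ.pt) (f' := 𝟙 W)
        (g := 𝟙 Y) (g' := 𝟙 W) (r := r) (Category.id_comp γ.pt) (Category.comp_id _))]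
    exact iff_of_eq (congrArg _ (funext fun ψ => γ.act_cart q ψ))
  exact ⟨fun H => Lifts.of_id fun r => (key r).1 (H r), fun H r => (key r).2 (H rfl)⟩

theorem isColimit_iff {γ : Cocone p f} :
    γ.IsColimit ↔ Lifts γ.legCell (leftUnitor (loId X)) :=
  respects_iff

theorem preserves_iff {g : X ⟶ X'} {γ : Cocone p f} {k : Z ⟶ X'} {k' : Y ⟶ X'}
    (e : f ≫ g = k) (e' : γ.pt ≫ g = k') :
    Preserves g γ ↔
      Lifts (vcomp (Row.single γ.legCell) (tightMap g) e e') (leftUnitor (loId X')) := by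
  subst e e'
  have h : (γ.map g).legCell = vcomp (Row.single γ.legCell) (tightMap g) rfl rfl :=
    factor_cart _ _ _
  rw [Preserves, isColimit_iff]
  exact iff_of_eq (congrArg (fun t => Lifts t (leftUnitor (loId X'))) h)

/-- A 2-cell into `X'(g, 1)` with left side `c` is a 2-cell into `X'(1, 1)` with left side `c ≫ g`.
Thus exactness of `X'(g, 1)` gives cocontinuity of `g`. -/
theorem Lifts.tightMap {c : Y ⟶ X} {κ : Cell f p c (loId X)} {g : X ⟶ X'}
    (H : Lifts κ (leftUnitor (hom g (𝟙 X')))) :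
    Lifts (vcomp (Row.single κ) (tightMap g) rfl rfl) (leftUnitor (loId X')) := by
  rintro V r k _ rfl
  have e : Function.Bijective fun φ : Cell c r k (hom g (𝟙 X')) =>
      vcomp (Row.single φ) (cart (loId X') g (𝟙 X')) rfl (Category.comp_id k) :=
    factor_bijective _ _
  rw [← Function.Bijective.of_comp_iff _ e]
  convert (factor_bijective (q := loId X') (f := g) (f' := 𝟙 X') rfl (Category.comp_id k)).comp
    (H (r := r) (g := k) rfl) using 1
  funext φ
  exact pair_tightMap_left κ φ (cart (loId X') g (𝟙 X')) rfl rfl rfl (Category.comp_id k)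

/-- The cocone determined by a 2-cell. -/
noncomputable def Cocone.ofCell {c : Y ⟶ X} (κ : Cell f p c (loId X)) : Cocone p f where
  pt := c
  leg := factor κ (Category.id_comp f) (Category.id_comp c)

theorem Cocone.ofCell_legCell {c : Y ⟶ X} (κ : Cell f p c (loId X)) :
    (Cocone.ofCell κ).legCell = κ :=
  factor_cart _ _ _

theorem Cocone.isColimit_ofCell {c : Y ⟶ X} {κ : Cell f p c (loId X)} :
    (Cocone.ofCell κ).IsColimit ↔ Lifts κ (leftUnitor (loId X)) := by
  rw [isColimit_iff]
  exact iff_of_eq (congrArg (fun t => Lifts t (leftUnitor (loId X))) (ofCell_legCell κ))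

/-- A loose-cell that respects one colimit cocone respects every other one. -/
theorem Lifts.of_isColimit {q : Loose W X} {c : Y ⟶ X} {κ : Cell f p c (loId X)}
    (hκ : Lifts κ (leftUnitor (loId X))) (hq : Lifts κ (leftUnitor q)) {c' : Y ⟶ X}
    {κ' : Cell f p c' (loId X)} (hκ' : Lifts κ' (leftUnitor (loId X))) :
    Lifts κ' (leftUnitor q) := by
  obtain ⟨σ, hσ⟩ := (hκ (r := Chain.nil Y) (g := c') p.append_nil.symm).2 κ'
  change pair κ σ _ _ = _ at hσ
  -- Two-out-of-three shows that the comparison `σ` lifts, hence is invertible; applied for `q`, it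
  -- then carries the property from `κ` to `κ'`.
  rw [← hσ, hκ.tight_pair_iff] at hκ'
  rw [← hσ, hq.tight_pair_iff]
  exact lifts_of_isTightInvertible hκ'.isTightInvertible q

end

/-! ### Transport along invertible globular 2-cells, and the counit of a lift. -/

section

variable {A B E V W X X' Y Z : Obj}

omit [StrictVirtualEquipment Obj] in
theorem nil_vcomp {f : A ⟶ B} {g : A ⟶ E} {q : Loose E B} (φ : Cell f (Chain.nil A) g q)
    (e : 𝟙 A ≫ f = f) (e' : 𝟙 A ≫ g = g) : vcomp (Row.nil (𝟙 A)) φ e e' = φ :=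
  idRow_vcomp φ e e'

omit [StrictVirtualEquipment Obj] in
theorem one_single_vcomp {f : A ⟶ B} {g : X ⟶ E} {m : Loose X A} {q : Loose E B}
    (φ : Cell f (Chain.single m) g q) (e : 𝟙 A ≫ f = f) (e' : 𝟙 X ≫ g = g) :
    vcomp (Row.single (one m)) φ e e' = φ :=
  idRow_vcomp φ e e'

omit [StrictVirtualEquipment Obj] in
theorem pair_one_one {π : Loose E B} {l : Loose W E} {q : Loose W B}
    (ϖ : Cell (𝟙 B) (Chain.cons π (Chain.single l)) (𝟙 W) q) :
    pair (one π) (one l) ϖ rfl = ϖ :=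
  idRow_vcomp ϖ _ _

theorem tightMap_id (X : Obj) : tightMap (𝟙 X) = one (loId X) := by
  refine loId_ext (Chain.nil X) (Chain.nil X) ?_
  refine (loIdCell_tightMap (𝟙 X)).trans ((tightId_id X).trans ?_)
  exact (vcomp_one _).symm

omit [StrictVirtualEquipment Obj] in
theorem pair_precomp {π π' : Loose E B} {l : Loose W E} {q : Loose W B}
    (u : Cell (𝟙 B) (Chain.single π) (𝟙 E) π')
    (ϖ : Cell (𝟙 B) (Chain.cons π' (Chain.single l)) (𝟙 W) q) {f : Z ⟶ B} {c : Y ⟶ E}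
    {g : V ⟶ W} {p : Weight Y Z} {r : Weight V Y} {ps : Weight V Z} (κ : Cell f p c π)
    (φ : Cell c r g l) (h : ps = p.append r) :
    pair κ φ (precomp u ϖ) h =
      pair (vcomp (Row.single κ) u (Category.comp_id f) (Category.comp_id c)) φ ϖ h := by
  have H : IsAppend (Row.single κ) (Row.single φ) (Row.cons κ (Row.single φ) h) :=
    IsAppend.cons _ _ _ (IsAppend.nil _)
  have e := vcomp_pair H u (one l) ϖ rfl h (Category.comp_id _) (Category.comp_id _)
    (Category.comp_id _)
  rw [vcomp_one] at e
  exact e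

omit [StrictVirtualEquipment Obj] in
theorem lifts_precomp_iff {π π' : Loose E B} {l : Loose W E} {q : Loose W B}
    (u : Cell (𝟙 B) (Chain.single π) (𝟙 E) π')
    (ϖ : Cell (𝟙 B) (Chain.cons π' (Chain.single l)) (𝟙 W) q) {f : Z ⟶ B} {c : Y ⟶ E}
    {p : Weight Y Z} (κ : Cell f p c π) :
    Lifts κ (precomp u ϖ) ↔
      Lifts (vcomp (Row.single κ) u (Category.comp_id f) (Category.comp_id c)) ϖ := by
  simp only [Lifts, pair_precomp]

omit [StrictVirtualEquipment Obj] in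
theorem vcomp_invertible_bijective {q q' : Loose W B}
    {θ : Cell (𝟙 B) (Chain.single q) (𝟙 W) q'} (hθ : IsInvertible θ) {f : Z ⟶ B} {g : V ⟶ W}
    {p : Weight V Z} :
    Function.Bijective fun φ : Cell f p g q =>
      vcomp (Row.single φ) θ (Category.comp_id f) (Category.comp_id g) := by
  obtain ⟨θ', h₁, h₂⟩ := hθ
  refine Function.bijective_iff_has_inverse.2 ⟨fun φ =>
    vcomp (Row.single φ) θ' (Category.comp_id f) (Category.comp_id g), fun φ => ?_, fun φ => ?_⟩
  · refine (vcomp_vcomp (Row.single φ) θ θ' (Category.comp_id _) (Category.comp_id _)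
      (Category.comp_id _) (Category.comp_id _) _ _ _ _).trans ?_
    exact (congrArg (fun t => vcomp _ t _ _) h₁).trans (vcomp_one φ)
  · refine (vcomp_vcomp (Row.single φ) θ' θ (Category.comp_id _) (Category.comp_id _)
      (Category.comp_id _) (Category.comp_id _) _ _ _ _).trans ?_
    exact (congrArg (fun t => vcomp _ t _ _) h₂).trans (vcomp_one φ)

omit [StrictVirtualEquipment Obj] in
theorem Lifts.gcomp_invertible {f : Z ⟶ B} {c : Y ⟶ E} {p : Weight Y Z} {π : Loose E B}
    {l : Loose W E} {q q' : Loose W B} {κ : Cell f p c π}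
    {ϖ : Cell (𝟙 B) (Chain.cons π (Chain.single l)) (𝟙 W) q} (H : Lifts κ ϖ)
    {θ : Cell (𝟙 B) (Chain.single q) (𝟙 W) q'} (hθ : IsInvertible θ) :
    Lifts κ (gcomp ϖ θ) := by
  intro V r g ps h
  refine Eq.mp (congrArg Function.Bijective (funext fun φ => ?_))
    ((vcomp_invertible_bijective hθ).comp (H h))
  exact pair_vcomp κ φ ϖ h θ _ _

/-- A 2-cell `ϖ : E(j, 1), l ⇒ p` lifting along the conjoint unit has an invertible counit. -/
theorem isInvertible_liftCounit {j : A ⟶ E} {l : Loose X E} {p : Loose X A}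
    {ϖ : Cell (𝟙 A) (Chain.cons (hom j (𝟙 E)) (Chain.single l)) (𝟙 X) p}
    (H : Lifts (conjointUnit j) ϖ) : IsInvertible (liftCounit ϖ) := by
  -- `μ : p ⇒ l` has left side `j`; its factorisation through `l(j, 1)` is the inverse of the
  -- counit.
  obtain ⟨μ, hμ⟩ := (H (r := Chain.single p) (g := 𝟙 X) rfl).2 (one p)
  have key : ∀ {m : Loose X A} (φ : Cell (𝟙 A) (Chain.single m) (𝟙 X) p),
      pair (conjointUnit j) (vcomp (Row.single φ) μ (Category.id_comp _) (Category.id_comp _)) ϖ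
        rfl = φ := by
    intro m φ
    have e := vcomp_pair (IsAppend.nil (Row.single φ)) (conjointUnit j) μ ϖ rfl rfl
      (Category.id_comp _) (Category.id_comp _) (Category.id_comp _)
    rw [nil_vcomp] at e
    refine e.symm.trans ((congrArg (fun t => vcomp _ t _ _) hμ).trans (vcomp_one φ))
  refine ⟨factor μ (Category.id_comp j) (Category.id_comp _), ?_, ?_⟩
  · refine cart_ext (Category.id_comp j) (Category.id_comp _) ?_
    refine (vcomp_vcomp _ _ _ (Category.id_comp _) (Category.id_comp _) (Category.id_comp _)
      (Category.id_comp _) _ _ _ _).trans ?_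
    refine (congrArg (fun t => vcomp _ t _ _) (factor_cart _ _ _)).trans ?_
    refine Eq.trans ?_ (one_single_vcomp _ _ _).symm
    exact (H (r := Chain.single (restr l j (𝟙 X))) (g := 𝟙 X) rfl).1 (key _)
  · have e := vcomp_pair (IsAppend.nil (Row.single
        (factor μ (Category.id_comp j) (Category.id_comp (𝟙 X))))) (conjointUnit j)
      (cart l j (𝟙 X)) ϖ rfl rfl
      (Category.id_comp _) (Category.id_comp _) (Category.id_comp _)
    rw [nil_vcomp, factor_cart] at e
    exact e.trans hμ

end

/-! ### Loose-cells that are conjoints of a tight-cell. -/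

/-- `η` and `ζ` exhibit `π` as the conjoint `E(y, 1)` of `y`. -/
structure IsConjoint {A E : Obj} {y : A ⟶ E} {π : Loose E A}
    (η : Cell (𝟙 A) (Chain.nil A) y π) (ζ : Cell y (Chain.single π) (𝟙 E) (loId E)) : Prop where
  pair_eq : pair η ζ (rightUnitor π) rfl = one π
  vcomp_eq : vcomp (Row.single η) ζ (Category.id_comp y) (Category.comp_id y) = tightId y

namespace IsConjoint

variable {A E : Obj} {y : A ⟶ E} {π : Loose E A}
  {η : Cell (𝟙 A) (Chain.nil A) y π} {ζ : Cell y (Chain.single π) (𝟙 E) (loId E)}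

/-- Conjoints of `y` are unique up to isomorphism compatible with their units. This moves results
from the weight `π` to the weight `E(y, 1)` occurring in `IsCocompletion`. -/
theorem exists_invertible (h : IsConjoint η ζ) :
    ∃ v : Cell (𝟙 A) (Chain.single (hom y (𝟙 E))) (𝟙 E) π, IsInvertible v ∧
      vcomp (Row.single (conjointUnit y)) v (Category.comp_id _) (Category.comp_id _) = η := by
  have hu := factor_cart ζ (Category.id_comp y) (Category.id_comp (𝟙 E))
  generalize factor ζ (Category.id_comp y) (Category.id_comp (𝟙 E)) = u at hu
  have h₁ : gcomp u (pair η (cart (loId E) y (𝟙 E)) (rightUnitor π) rfl) = one π := by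
    have e := vcomp_pair (IsAppend.nil (Row.single u)) η (cart (loId E) y (𝟙 E)) (rightUnitor π)
      rfl rfl (Category.id_comp _) (Category.id_comp _) (Category.id_comp _)
    rw [nil_vcomp, hu] at e
    exact e.trans h.pair_eq
  refine ⟨pair η (cart (loId E) y (𝟙 E)) (rightUnitor π) rfl, ⟨u, ?_, h₁⟩, ?_⟩
  · refine cart_ext (Category.id_comp _) (Category.id_comp _) ?_
    refine (vcomp_vcomp _ _ _ (Category.id_comp _) (Category.id_comp _) (Category.id_comp _)
      (Category.id_comp _) _ _ _ _).trans ?_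
    refine (congrArg (fun t => vcomp _ t _ _) hu).trans ?_
    refine Eq.trans ?_ (one_single_vcomp _ _ _).symm
    have e := pair_tightMap_right η (cart (loId E) y (𝟙 E)) ζ rfl (Category.id_comp y)
      (Category.comp_id y) (Category.comp_id _)
    rw [h.vcomp_eq, tightMap_id, vcomp_one, ← leftUnitor_loId] at e
    exact e.symm.trans (tightId_pair _)
  · have h₂ : vcomp (Row.single η) u (Category.comp_id _) (Category.comp_id _) =
        conjointUnit y := by
      refine cart_ext (Category.id_comp _) (Category.comp_id _) ?_
      refine (vcomp_vcomp _ _ _ (Category.id_comp _) (Category.comp_id _) (Category.id_comp _)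
        (Category.comp_id _) _ _ _ _).trans ?_
      refine (congrArg (fun t => vcomp _ t _ _) hu).trans ?_
      exact h.vcomp_eq.trans (conjointUnit_cart y).symm
    rw [← h₂]
    refine (vcomp_vcomp _ _ _ (Category.comp_id _) (Category.comp_id _) (Category.comp_id _)
        (Category.comp_id _) _ _ _ _).trans ?_
    exact (congrArg (fun t => vcomp _ t _ _) h₁).trans (vcomp_one η)

end IsConjoint

namespace IsConjoint

variable {A E X : Obj} {y : A ⟶ E} {π : Loose E A}
  {η : Cell (𝟙 A) (Chain.nil A) y π} {ζ : Cell y (Chain.single π) (𝟙 E) (loId E)}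

/-- The 2-cell `π, p ⇒ p(y, 1)` induced by a conjoint. -/
noncomputable def bend (ζ : Cell y (Chain.single π) (𝟙 E) (loId E)) (p : Loose X E) :
    Cell (𝟙 A) (Chain.cons π (Chain.single p)) (𝟙 X) (restr p y (𝟙 X)) :=
  factor (pair ζ (one p) (leftUnitor p) rfl) (Category.id_comp y) (Category.id_comp _)

theorem bend_cart (ζ : Cell y (Chain.single π) (𝟙 E) (loId E)) (p : Loose X E) :
    vcomp (Row.single (bend ζ p)) (cart p y (𝟙 X)) (Category.id_comp y) (Category.id_comp _) =
      pair ζ (one p) (leftUnitor p) rfl :=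
  factor_cart _ _ _

theorem pair_bend (h : IsConjoint η ζ) (p : Loose X E) :
    pair η (cart p y (𝟙 X)) (bend ζ p) rfl = one (restr p y (𝟙 X)) := by
  refine cart_ext (Category.id_comp _) (Category.id_comp _) ?_
  refine (pair_vcomp η (cart p y (𝟙 X)) (bend ζ p) rfl (cart p y (𝟙 X)) _ _).trans ?_
  refine (congrArg (fun t => vcomp _ t _ _) (bend_cart ζ p)).trans ?_
  have H : IsAppend (Row.single η) (Row.single (cart p y (𝟙 X)))
      (Row.cons η (Row.single (cart p y (𝟙 X))) rfl) := IsAppend.cons _ _ _ (IsAppend.nil _)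
  have e := vcomp_pair H ζ (one p) (leftUnitor p) rfl rfl (Category.id_comp _)
    (Category.comp_id _) (Category.comp_id _)
  rw [h.vcomp_eq, vcomp_one] at e
  exact e.trans ((tightId_pair _).trans (one_single_vcomp _ _ _).symm)

theorem bend_pair (h : IsConjoint η ζ) {p : Loose X E} {q : Loose X A}
    (χ : Cell (𝟙 A) (Chain.cons π (Chain.single p)) (𝟙 X) q) :
    gcomp (bend ζ p) (pair η (cart p y (𝟙 X)) χ rfl) = χ := by
  have e := vcomp_pair (IsAppend.nil (Row.single (bend ζ p))) η (cart p y (𝟙 X)) χ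
      rfl rfl (Category.id_comp _) (Category.id_comp _) (Category.id_comp _)
  rw [nil_vcomp, bend_cart] at e
  refine e.trans ?_
  refine (pair_pair_middle η ζ (one p) χ rfl rfl rfl rfl).symm.trans ?_
  rw [h.pair_eq]
  exact pair_one_one χ

/-- A loose-cell respecting the colimit `ζ` is the right lift through `π` of its own restriction
along `y`. -/
theorem lifts_bend {p : Loose X E} (H : Lifts ζ (leftUnitor p)) : Lifts (one π) (bend ζ p) := by
  intro V r g ps h
  have e : Function.Bijective fun φ : Cell (𝟙 A) ps g (restr p y (𝟙 X)) =>
      vcomp (Row.single φ) (cart p y (𝟙 X)) (Category.id_comp _) (Category.comp_id _) :=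
    factor_bijective _ _
  rw [← Function.Bijective.of_comp_iff' e]
  refine Eq.mp (congrArg Function.Bijective (funext fun φ => ?_)) (H h)
  refine Eq.symm ((pair_vcomp (one π) φ (bend ζ p) h (cart p y (𝟙 X)) _ _).trans ?_)
  refine (congrArg (fun t => vcomp _ t _ _) (bend_cart ζ p)).trans ?_
  have H : IsAppend (Row.single (one π)) (Row.single φ) (Row.cons (one π) (Row.single φ) h) :=
    IsAppend.cons _ _ _ (IsAppend.nil _)
  have e := vcomp_pair H ζ (one p) (leftUnitor p) rfl h (Category.id_comp _)
    (Category.id_comp _) (Category.comp_id _)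
  rw [one_single_vcomp, vcomp_one] at e
  exact e

/-- A 2-cell out of a conjoint is recovered from its composite with the unit. -/
theorem pair_tightMap (h : IsConjoint η ζ) {f : A ⟶ X} {f' : E ⟶ X}
    (χ : Cell f (Chain.single π) f' (loId X)) :
    pair (vcomp (Row.single η) χ (Category.id_comp f) rfl)
      (vcomp (Row.single ζ) (tightMap f') rfl (Category.id_comp f')) (leftUnitor (loId X)) rfl =
      χ := by
  rw [leftUnitor_loId]
  refine (pair_tightMap_right η ζ χ rfl _ _ _).trans ?_
  exact (congrArg (fun t => vcomp (Row.single t) χ (Category.id_comp _) (Category.id_comp _))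
    h.pair_eq).trans (one_single_vcomp _ _ _)

theorem vcomp_tightMap (h : IsConjoint η ζ) (f' : E ⟶ X) :
    vcomp (Row.single η) (vcomp (Row.single ζ) (tightMap f') rfl (Category.id_comp f'))
      (Category.id_comp _) rfl = tightId (y ≫ f') := by
  refine (vcomp_vcomp (Row.single η) ζ (tightMap f') rfl (Category.id_comp f')
    (Category.id_comp _) rfl (Category.id_comp y) (Category.comp_id y) rfl rfl).symm.trans ?_
  exact (congrArg (fun t => vcomp (Row.single t) (tightMap f') rfl rfl) h.vcomp_eq).trans
    (tightId_tightMap y f')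

end IsConjoint

/-! ### Presheaf objects: the embedding, colimits and uniqueness of extensions. -/

section

variable {A B E W X Y Z : Obj}

/-- The cartesian 2-cells of `q(c, 1)` and `q(f, 1)` turn pairing under `γ.act q` into pairing with
the unit of the extension. Taking `q` a loose-identity shows that unit invertible. -/
theorem Lifts.vcomp_legCell {y : A ⟶ E} {π : Loose E A} {η : Cell (𝟙 A) (Chain.nil A) y π}
    {f : A ⟶ X} {γ : Cocone (Chain.single π) f} {q : Loose W X}
    (H : Lifts (p := Chain.nil A) η (γ.act q)) :
    Lifts (vcomp (Row.single η) γ.legCell (Category.id_comp f) rfl) (leftUnitor q) := by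
  intro V r g ps h
  have e₁ : Function.Bijective fun φ : Cell y r g (restr q γ.pt (𝟙 W)) =>
      vcomp (Row.single φ) (cart q γ.pt (𝟙 W)) rfl (Category.comp_id g) :=
    factor_bijective _ _
  have e₂ : Function.Bijective fun φ : Cell (𝟙 A) ps g (restr q f (𝟙 W)) =>
      vcomp (Row.single φ) (cart q f (𝟙 W)) (Category.id_comp f) (Category.comp_id g) :=
    factor_bijective _ _
  rw [← Function.Bijective.of_comp_iff _ e₁]
  refine Eq.mp (congrArg Function.Bijective (funext fun φ => ?_)) (e₂.comp (H h))
  refine (pair_vcomp η φ (γ.act q) h (cart q f (𝟙 W)) _ _).trans ?_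
  refine (congrArg (fun t => vcomp _ t _ _) (factor_cart _ _ _)).trans ?_
  have H : IsAppend (Row.single η) (Row.single φ) (Row.cons η (Row.single φ) h) :=
    IsAppend.cons _ _ _ (IsAppend.nil _)
  exact vcomp_pair H γ.legCell (cart q γ.pt (𝟙 W)) (leftUnitor q) rfl h _ _ _

/-- A presheaf object with a presheaf embedding makes `π` the conjoint of the embedding, whose
unit lifts along every right lift through `π`. -/
theorem exists_isConjoint {y : A ⟶ E} {π : Loose E A} (hπ : IsDense π)
    (hy : IsPresheafEmbedding π y) :
    ∃ (η : Cell (𝟙 A) (Chain.nil A) y π) (ζ : Cell y (Chain.single π) (𝟙 E) (loId E)),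
      IsConjoint η ζ ∧ ∀ ⦃W : Obj⦄ {l : Loose W E} {q : Loose W A}
        {ϖ : Cell (𝟙 A) (Chain.cons π (Chain.single l)) (𝟙 W) q}, Lifts (one π) ϖ →
        Lifts η ϖ := by
  obtain ⟨a, ha⟩ := hy
  -- `η` is the nullary 2-cell of `A(1, 1)`, followed by `A(1, 1) ≅ π(1, y)` and the cartesian
  -- 2-cell; the first two form a left-opcartesian 2-cell.
  have hη : ∀ ⦃W : Obj⦄ {l : Loose W E} {q : Loose W A}
        {ϖ : Cell (𝟙 A) (Chain.cons π (Chain.single l)) (𝟙 W) q}, Lifts (one π) ϖ →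
        Lifts (vcomp (Row.single (gcomp (loIdCell A) a)) (cart π (𝟙 A) y) (Category.id_comp _)
          (Category.id_comp _)) ϖ := fun W l q ϖ h =>
    (lifts_cart h y).leftOpcartesian ((isLeftOpcartesian_loIdCell A).comp_invertible ha)
  generalize vcomp (Row.single (gcomp (loIdCell A) a)) (cart π (𝟙 A) y) (Category.id_comp _)
          (Category.id_comp _) = η at hη
  have hD := hη (lifts_one_iff.2 hπ)
  -- Density makes `η` lift along `rightUnitor π`, so the identity of `π` determines `ζ`; the second
  -- triangle identity follows by injectivity.
  obtain ⟨ζ, hζ⟩ := (hD (r := Chain.single π) (g := 𝟙 E) rfl).2 (one π)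
  refine ⟨η, ζ, ⟨hζ, ?_⟩, hη⟩
  refine (hD (r := Chain.nil A) (g := y) rfl).1 ?_
  have e := vcomp_pair (IsAppend.nil (Row.single η)) η ζ (rightUnitor π)
      rfl rfl (Category.id_comp _) (Category.id_comp _) (Category.comp_id _)
  rw [nil_vcomp] at e
  refine e.symm.trans ?_
  refine (congrArg (fun t => vcomp _ t _ _) hζ).trans ?_
  exact (vcomp_one η).trans (pair_tightId η _).symm

/-- Colimits in a presheaf object, respected by all right lifts through `π`. -/
theorem IsPresheafObject.exists_lifts {Φ : WeightClass Obj} {P : LooseClass Obj} {π : Loose E A}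
    (hπ : IsPresheafObject P π)
    (hcomp : ∀ ⦃X Y B : Obj⦄ (p : Weight Y X) (q : Loose X B), Φ p → P q →
      ∃ (s : Loose Y B) (ω : Cell (𝟙 B) (Chain.cons q p) (𝟙 Y) s),
        IsLeftOpcartesian ω ∧ repletion P s)
    {p : Weight Y Z} (hp : Φ p) (f : Z ⟶ E) :
    ∃ (c : Y ⟶ E) (κ : Cell f p c (loId E)), ∀ ⦃W : Obj⦄ {l : Loose W E} {q : Loose W A}
        {ϖ : Cell (𝟙 A) (Chain.cons π (Chain.single l)) (𝟙 W) q}, Lifts (one π) ϖ →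
        Lifts κ (leftUnitor l) := by
  obtain ⟨s, ω, hω, s', hs', φ, hφ⟩ := hcomp p (restr π (𝟙 A) f) hp (hπ.mem f)
  obtain ⟨c, hc, -⟩ := hπ.existsUnique s' hs'
  subst hc
  obtain ⟨φ', hφ'⟩ := hφ.symm
  have hω' := hω.comp_invertible hφ'
  have hD := lifts_cart (lifts_one_iff.2 hπ.dense) f
  -- Density produces `κ` before any `ϖ` is chosen, so a single cocone serves all right lifts.
  obtain ⟨κ, hκ⟩ := (hD (r := p) (g := c) (ps := Chain.cons (restr π (𝟙 A) f) p) rfl).2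
    (vcomp (Row.single (gcomp ω φ')) (cart π (𝟙 A) c) (Category.id_comp _) (Category.id_comp _))
  change pair _ κ _ _ = _ at hκ
  refine ⟨c, κ, fun W l q ϖ h => ?_⟩
  -- Two-out-of-three: the cartesian 2-cell of `π(1, f)` lifts, and so does its pairing with `κ`,
  -- which is the left-opcartesian 2-cell into `π(1, c)` followed by a cartesian one.
  refine ((lifts_cart h f).pair_iff (ps := Chain.cons (restr π (𝟙 A) f) p) rfl).1 ?_
  rw [hκ]
  exact (lifts_cart h c).leftOpcartesian hω'

theorem extUnit_ofCell {j : A ⟶ E} {f : A ⟶ X} {c : E ⟶ X}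
    (κ : Cell f (Chain.single (hom j (𝟙 E))) c (loId X)) :
    extUnit (Cocone.ofCell κ) =
      vcomp (Row.single (conjointUnit j)) κ (Category.id_comp f) rfl :=
  congrArg (fun t => vcomp (Row.single (conjointUnit j)) t (Category.id_comp f) rfl)
    (Cocone.ofCell_legCell κ)

section

variable {y : A ⟶ E} {π : Loose E A} {η : Cell (𝟙 A) (Chain.nil A) y π}
  {ζ : Cell y (Chain.single π) (𝟙 E) (loId E)}

/-- Uniqueness of extensions along `y` preserving the colimit `ζ`. -/
theorem IsConjoint.existsUnique_tightCell (h : IsConjoint η ζ) {f : A ⟶ X} {c : E ⟶ X}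
    {κ : Cell f (Chain.single π) c (loId X)} (hκ : Lifts κ (leftUnitor (loId X))) {f' : E ⟶ X}
    (hf' : Lifts (vcomp (Row.single ζ) (tightMap f') rfl (Category.id_comp f'))
      (leftUnitor (loId X))) {θ : TightCell f (y ≫ f')} (hθ : IsTightInvertible θ) :
    ∃! σ : TightCell c f', IsTightInvertible σ ∧
      tightComp (vcomp (Row.single η) κ (Category.id_comp f) rfl) (whiskerLeft y σ) = θ := by
  have key : ∀ σ : TightCell c f',
      tightComp (vcomp (Row.single η) κ (Category.id_comp f) rfl) (whiskerLeft y σ) =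
      vcomp (Row.single η) (pair κ σ (leftUnitor (loId X)) rfl) (Category.id_comp f) rfl := by
    intro σ
    exact (vcomp_pair (IsAppend.append_nil (Row.single η)) κ σ (leftUnitor (loId X)) rfl rfl
      (Category.id_comp f) rfl rfl).symm
  obtain ⟨σ, hσ⟩ := (hκ (r := Chain.nil E) (g := f') (ps := Chain.single π) rfl).2
    (pair θ (vcomp (Row.single ζ) (tightMap f') rfl (Category.id_comp f')) (leftUnitor (loId X))
      rfl)
  change pair κ σ _ _ = _ at hσ
  -- Transported along `θ`, the preserved colimit `ζ` exhibits `f'` as a `π`-colimit of `f`, so `σ`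
  -- compares two colimits.
  have hθ' := (lifts_of_isTightInvertible hθ (loId X)).tight_pair_iff (ps := Chain.single π) rfl
    |>.2 hf'
  refine ⟨σ, ⟨?_, ?_⟩, ?_⟩
  · exact ((hκ.tight_pair_iff (ps := Chain.single π) rfl).1
      ((congrArg (fun t => Lifts t (leftUnitor (loId X))) hσ).mpr hθ')).isTightInvertible
  · rw [key]
    refine (congrArg (fun t => vcomp (Row.single η) t (Category.id_comp f) rfl) hσ).trans ?_
    have e := vcomp_pair (IsAppend.nil (Row.single η)) θ
      (vcomp (Row.single ζ) (tightMap f') rfl (Category.id_comp f')) (leftUnitor (loId X))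
      rfl rfl (Category.id_comp _) (Category.id_comp _) rfl
    rw [nil_vcomp, h.vcomp_tightMap, leftUnitor_loId] at e
    rw [leftUnitor_loId]
    exact e.trans (pair_tightId θ _)
  · rintro τ ⟨-, hτ⟩
    rw [key] at hτ
    refine (hκ (r := Chain.nil E) (g := f') (ps := Chain.single π) rfl).1 (Eq.trans ?_ hσ.symm)
    -- Uniqueness: a 2-cell out of `π` is determined by its composite with `η`.
    refine (h.pair_tightMap _).symm.trans ?_
    exact congrArg (fun t => pair t _ (leftUnitor (loId X)) rfl) hτ

/-- Uniqueness of loose-cells extending along `y` and respecting the colimit `ζ`. -/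
theorem IsConjoint.existsUnique_cell (h : IsConjoint η ζ) {l p' : Loose X E} {p : Loose X A}
    {ϖ : Cell (𝟙 A) (Chain.cons π (Chain.single l)) (𝟙 X) p} (hϖ : Lifts (one π) ϖ)
    {v : Cell (𝟙 A) (Chain.single (hom y (𝟙 E))) (𝟙 E) π}
    (hv : vcomp (Row.single (conjointUnit y)) v (Category.comp_id _) (Category.comp_id _) = η)
    (hp' : Lifts ζ (leftUnitor p'))
    {θ : Cell (𝟙 A) (Chain.single (restr p' y (𝟙 X))) (𝟙 X) p} (hθ : IsInvertible θ) :
    ∃! σ : Cell (𝟙 E) (Chain.single p') (𝟙 X) l,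
      IsInvertible σ ∧ gcomp (restrMap σ y (𝟙 X)) (liftCounit (precomp v ϖ)) = θ := by
  have key : ∀ σ : Cell (𝟙 E) (Chain.single p') (𝟙 X) l,
      gcomp (restrMap σ y (𝟙 X)) (liftCounit (precomp v ϖ)) =
      pair η (cart p' y (𝟙 X)) (pair (one π) σ ϖ rfl) rfl := by
    intro σ
    have e := vcomp_pair (IsAppend.nil (Row.single (restrMap σ y (𝟙 X)))) (conjointUnit y)
      (cart l y (𝟙 X)) (precomp v ϖ) rfl rfl (Category.id_comp _) (Category.id_comp _)
      (Category.id_comp _)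
    rw [nil_vcomp, restrMap, factor_cart] at e
    refine e.trans ((pair_precomp v ϖ _ _ _).trans ?_)
    rw [hv]
    have H : IsAppend (Row.single η) (Row.single (cart p' y (𝟙 X)))
        (Row.cons η (Row.single (cart p' y (𝟙 X))) rfl) := IsAppend.cons _ _ _ (IsAppend.nil _)
    have e' := vcomp_pair H (one π) σ ϖ rfl rfl (Category.comp_id _) (Category.comp_id _)
      (Category.comp_id _)
    rw [vcomp_one] at e'
    exact e'.symm
  -- Both `p'` and `l` are now right lifts of `p` through `π`, and `σ` is the comparison.
  have hδ := (IsConjoint.lifts_bend hp').gcomp_invertible hθ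
  obtain ⟨σ, hσ⟩ := (hϖ (r := Chain.single p') (g := 𝟙 X) rfl).2
    (gcomp (IsConjoint.bend ζ p') θ)
  change pair (one π) σ _ _ = _ at hσ
  refine ⟨σ, ⟨hδ.isInvertible hϖ hσ, ?_⟩, ?_⟩
  · rw [key]
    refine (congrArg (fun t => pair η (cart p' y (𝟙 X)) t rfl) hσ).trans ?_
    refine (pair_vcomp η (cart p' y (𝟙 X)) (IsConjoint.bend ζ p') rfl θ (Category.comp_id _)
      (Category.comp_id _)).symm.trans ?_
    exact (congrArg (fun t => vcomp (Row.single t) θ (Category.comp_id _) (Category.comp_id _))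
      (h.pair_bend p')).trans (one_single_vcomp _ _ _)
  · rintro τ ⟨-, hτ⟩
    rw [key] at hτ
    refine (hϖ (r := Chain.single p') (g := 𝟙 X) rfl).1 (Eq.trans ?_ hσ.symm)
    refine (h.bend_pair _).symm.trans ?_
    exact congrArg (fun t => gcomp (IsConjoint.bend ζ p') t) hτ

end

end

end StrictVirtualEquipment

end FormalCat

/-! ### The cocompletion theorem. -/

theorem mainTheorem1 {Obj : Type u} [VirtualDoubleCategory.{u, v, w, z} Obj]
    [StrictVirtualEquipment Obj]
    (Φ : WeightClass Obj) (P : LooseClass Obj) {A PA : Obj} (π : Loose PA A)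
    (hπ : IsPresheafObject P π) (hA : repletion P (loId A))
    (hcomp : ∀ ⦃X Y B : Obj⦄ (p : Weight Y X) (q : Loose X B), Φ p → P q →
      ∃ (s : Loose Y B) (ω : Cell (𝟙 B) (Chain.cons q p) (𝟙 Y) s),
        IsLeftOpcartesian ω ∧ repletion P s)
    (hsat : saturation Φ (Chain.single π))
    (hlift : IsLifting (Chain.single π)) :
    (∃ y : A ⟶ PA, IsPresheafEmbedding π y) ∧
      ∀ y : A ⟶ PA, IsPresheafEmbedding π y → IsCocompletion Φ y := by
  constructor
  · obtain ⟨q, hq, φ, hφ⟩ := hA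
    obtain ⟨y, rfl, -⟩ := hπ.existsUnique q hq
    exact ⟨y, hφ.symm⟩
  intro y hy
  obtain ⟨η, ζ, hηζ, hη⟩ := exists_isConjoint hπ.dense hy
  obtain ⟨v, hv, hvη⟩ := hηζ.exists_invertible
  have hE : IsCocomplete Φ PA := fun Y Z p hp f =>
    let ⟨_, κ, hκ⟩ := hπ.exists_lifts hcomp hp f
    ⟨Cocone.ofCell κ, Cocone.isColimit_ofCell.2 (hκ (lifts_one_iff.2 hπ.dense))⟩
  have hexact : ∀ ⦃W : Obj⦄ {l : Loose W PA} {q : Loose W A}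
      {ϖ : Cell (𝟙 A) (Chain.cons π (Chain.single l)) (𝟙 W) q}, Lifts (one π) ϖ →
      IsExact Φ l := fun W l q ϖ h => ⟨hE, fun Y Z p hp f γ hγ =>
    let ⟨_, _, hκ⟩ := hπ.exists_lifts hcomp hp f
    respects_iff.2 ((hκ (lifts_one_iff.2 hπ.dense)).of_isColimit (hκ h) (isColimit_iff.1 hγ))⟩
  -- The identity of `PA` is the `π`-colimit of `y`: pairing `η` with `ζ` gives the identity of `π`,
  -- so density and two-out-of-three apply.
  have hζ : (Cocone.ofCell ζ).IsColimit := by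
    refine Cocone.isColimit_ofCell.2 ?_
    refine ((hη (lifts_one_iff.2 hπ.dense)).pair_iff (ps := Chain.single π) rfl).1 ?_
    exact (congrArg (fun t => Lifts t (rightUnitor π)) hηζ.pair_eq).mpr
      (lifts_one_iff.2 hπ.dense)
  have hΦ := (saturation_spec Φ).1.1
  refine ⟨hE, ?_, ?_⟩
  · intro X f hX
    obtain ⟨γ, hγ⟩ := hΦ.cocomplete X hX _ hsat f
    have hγ' := isColimit_iff.1 hγ
    have hγ₁ : Lifts (one π) (γ.act (loId X)) := lifts_one_iff.2 hγ
    -- The colimit weighted by `π` is moved along `v` to the weight `E(y, 1)`; its unit is then `η`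
    -- followed by the original cocone.
    have hδ : extUnit (Cocone.ofCell
        (vcomp (Row.single v) γ.legCell (Category.id_comp _) (Category.id_comp _))) =
        vcomp (Row.single η) γ.legCell (Category.id_comp f) rfl := by
      rw [extUnit_ofCell, ← hvη]
      exact (vcomp_vcomp _ _ _ _ _ _ _ _ _ _ _).symm
    refine ⟨_, Cocone.isColimit_ofCell.2 (hγ'.invertible hv), ?_, ⟨hE, ?_⟩, ?_⟩
    · rw [hδ]
      exact (hη hγ₁).vcomp_legCell.isTightInvertible
    · intro Y Z p hp f' γ' hγ'
      refine (preserves_iff rfl rfl).2 (Lifts.tightMap ?_)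
      exact respects_iff.1 ((hexact hγ₁).respects p hp f' γ' hγ')
    · intro f' hf' θ hθ
      -- Saturation lets `Φ`-cocontinuity apply to the weight `π`, which need not lie in `Φ`.
      have hf'₁ := (preserves_iff rfl (Category.id_comp f')).1
        ((hΦ.cocontinuous f' hf').preserves _ hsat y (Cocone.ofCell ζ) hζ)
      rw [Cocone.ofCell_legCell] at hf'₁
      rw [hδ]
      exact hηζ.existsUnique_tightCell hγ' hf'₁ hθ
  · intro X p
    obtain ⟨l, ϖ, hϖ⟩ : ∃ (l : Loose X PA)
        (ϖ : Cell (𝟙 A) (Chain.cons π (Chain.single l)) (𝟙 X) p), Lifts (one π) ϖ :=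
      let ⟨l, ϖ, hϖ⟩ := hlift p
      ⟨l, ϖ, lifts_one_iff.2 hϖ⟩
    -- Precomposition with `v` turns the right lift through `π` into one through `E(y, 1)`.
    refine ⟨l, precomp v ϖ, lifts_one_iff.1 ?_, isInvertible_liftCounit ?_, hexact hϖ, ?_⟩
    · refine (lifts_precomp_iff v ϖ _).2 ?_
      rw [one_single_vcomp]
      have := hϖ.invertible hv
      rwa [vcomp_one] at this
    · refine (lifts_precomp_iff v ϖ _).2 ?_
      rw [hvη]
      exact hη hϖ
    · intro p' hp' θ hθ
      have hp'₁ := respects_iff.1 ((hΦ.exact p' hp').respects _ hsat y (Cocone.ofCell ζ) hζ)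
      rw [Cocone.ofCell_legCell] at hp'₁
      exact hηζ.existsUnique_cell hϖ hvη hp'₁ hθ
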